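/- Let $\mathcal A$ be a commutative $\mathbb C$-algebra and $\mathcal C=\mathcal A[[t_1,t_2,\dots]]$ the ring of formal power series in infinitely many variables. Write $\mathbb Z\times\mathbb Z$ matrices over $\mathcal C$ as $A=\sum_{j\le N}a_j(s)\Lambda^j$ for some $N$, where $\Lambda=(\delta_{\mu+1,\nu})_{\mu,\nu\in\mathbb Z}$ and $a_j(s)\in\mathcal C$ stands for the diagonal matrix with $s$-th diagonal entry $a_j(s)$; put $A_+=\sum_{j\ge0}a_j(s)\Lambda^j$, and let $\partial/\partial t_n$ act entrywise. Let $\{B_n\}_{n\ge1}$ be matrices of the form $B_n=\sum_{j=0}^n b^{(n)}_j(s)\Lambda^j$ with $b^{(n)}_n(s)=1$ that satisfy the Zakharov–Shabat equations $$\frac{\partial B_m}{\partial t_n}-\frac{\partial B_n}{\partial t_m}+[B_m,B_n]=0,\qquad m,n=1,2,\dots$$ Then there exists a matrix $$L=\Lambda+u_0(s)+u_{-1}(s)\Lambda^{-1}+\cdots\quad\text{such that}\quad \frac{\partial L}{\partial t_n}=[B_n,L],\qquad n=1,2,\dots$$ Moreover, for every such $L$ there are an invertible formal change of variables $t\mapsto\tilde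 t$, where $\tilde t_n-t_n$ is a power series without constant term in $t_{n+1},t_{n+2},\dots$ only and the inverse change is of the same form, and a series $f_0\in\mathcal C$, such that: 1. $\dfrac{\partial L}{\partial\tilde t_n}=[(L^n)_+,L]$ for all $n\ge1$; that is, $L$, rewritten as a function of $\tilde t$, is a Lax operator of the matrix mKP hierarchy with times $\tilde t_1,\tilde t_2,\dots$; 2. $\displaystyle B_n=\sum_{k=1}^n\frac{\partial\tilde t_k}{\partial t_n}(L^k)_+ +\frac{\partial f_0}{\partial t_n}$ for all $n\ge1$ (the last term times the identity matrix). -/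

import Mathlib

/-- The `ℤ × ℤ` matrices `∑_{k ≤ N} a_k(s) Λ^k` (some `N`): all entries more than `N` steps above
the main diagonal vanish. -/
def bandSubmodule (R : Type*) [CommRing R] : Submodule R (Matrix ℤ ℤ R) where
  carrier := {A | ∃ N : ℤ, ∀ i j : ℤ, i + N < j → A i j = 0}
  zero_mem' := ⟨0, fun _ _ _ => rfl⟩
  add_mem' := by
    rintro A B ⟨N, hN⟩ ⟨M, hM⟩
    refine ⟨max N M, fun i j h => ?_⟩
    have h1 := le_max_left N M
    have h2 := le_max_right N M
    rw [Matrix.add_apply, hN i j (by omega), hM i j (by omega), add_zero]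
  smul_mem' := by
    rintro c A ⟨N, hN⟩
    exact ⟨N, fun i j h => by rw [Matrix.smul_apply, hN i j h, smul_zero]⟩

/-- The type of `ℤ × ℤ` matrices of the form `∑_{k ≤ N} a_k(s) Λ^k`. -/
abbrev BandMat (R : Type*) [CommRing R] : Type _ := bandSubmodule R

namespace BandMat

variable {R S : Type*} [CommRing R] [CommRing S]

theorem ext' {A B : BandMat R} (h : ∀ i j, A.1 i j = B.1 i j) : A = B :=
  Subtype.ext (Matrix.ext h)

/-- The coefficient `a_j(s)` in `A = ∑_j diag_s[a_j(s)] Λ^j`, where `Λ = (δ_{μ+1,ν})`: the entry in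
row `s` on the `j`-th diagonal. -/
def coeff (A : BandMat R) (j s : ℤ) : R := A.1 s (s + j)

theorem mul_entry_eq_sum {A B : Matrix ℤ ℤ R} {N M : ℤ}
    (hA : ∀ i j : ℤ, i + N < j → A i j = 0) (hB : ∀ i j : ℤ, i + M < j → B i j = 0)
    {i j a b : ℤ} (ha : a ≤ j - M) (hb : i + N ≤ b) :
    ∑ᶠ k, A i k * B k j = ∑ k ∈ Finset.Icc a b, A i k * B k j := by
  refine finsum_eq_sum_of_support_subset _ fun k hk => ?_
  rw [Function.mem_support] at hk
  rw [Finset.coe_Icc, Set.mem_Icc]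
  by_contra hcon
  apply hk
  by_cases h : i + N < k
  · rw [hA i k h, zero_mul]
  · rw [hB k j (by omega), mul_zero]

/-- The matrix product; every entry is a finite sum. -/
noncomputable instance : Mul (BandMat R) where
  mul A B := ⟨Matrix.of fun i j => ∑ᶠ k, A.1 i k * B.1 k j, by
    obtain ⟨N, hN⟩ := A.2
    obtain ⟨M, hM⟩ := B.2
    refine ⟨N + M, fun i j h => ?_⟩
    rw [Matrix.of_apply, mul_entry_eq_sum hN hM le_rfl le_rfl, Finset.Icc_eq_empty (by omega), Finset.sum_empty]⟩

theorem mul_entry (A B : BandMat R) (i j : ℤ) :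
    (A * B).1 i j = ∑ᶠ k, A.1 i k * B.1 k j := rfl

/-- The identity matrix. -/
instance : One (BandMat R) where
  one := ⟨1, 0, fun _ _ h => Matrix.one_apply_ne (by omega)⟩

theorem one_entry (i j : ℤ) : (1 : BandMat R).1 i j = if i = j then 1 else 0 := by
  change (1 : Matrix ℤ ℤ R) i j = _
  rw [Matrix.one_apply]

theorem add_entry (A B : BandMat R) (i j : ℤ) : (A + B).1 i j = A.1 i j + B.1 i j := rfl

theorem smul_entry (c : R) (A : BandMat R) (i j : ℤ) : (c • A).1 i j = c * A.1 i j := rfl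

protected theorem mul_assoc (A B C : BandMat R) : A * B * C = A * (B * C) := by
  obtain ⟨N, hN⟩ := A.2
  obtain ⟨M, hM⟩ := B.2
  obtain ⟨P, hP⟩ := C.2
  obtain ⟨NM, hNM⟩ := (A * B).2
  obtain ⟨MP, hMP⟩ := (B * C).2
  refine ext' fun i j => ?_
  rw [mul_entry, mul_entry,
    mul_entry_eq_sum hNM hP (min_le_left (j - P) (j - P)) (le_max_left (i + NM) (i + N + M)),
    mul_entry_eq_sum hN hMP (min_le_left (j - MP) (j - P - M)) (le_max_left (i + N) (i + N))]
  simp only [min_self, max_self]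
  set b := max (i + NM) (i + N + M)
  set a := min (j - MP) (j - P - M)
  have ha : a ≤ j - P - M := min_le_right _ _
  have hb : i + N + M ≤ b := le_max_right _ _
  have h1 : ∀ l ∈ Finset.Icc (j - P) b, (A * B).1 i l * C.1 l j =
      ∑ k ∈ Finset.Icc a (i + N), A.1 i k * B.1 k l * C.1 l j := by
    intro l hl
    rw [Finset.mem_Icc] at hl
    rw [mul_entry, mul_entry_eq_sum hN hM (a := a) (b := i + N) (by omega) le_rfl,
      Finset.sum_mul]
  have h2 : ∀ k ∈ Finset.Icc a (i + N), A.1 i k * (B * C).1 k j =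
      ∑ l ∈ Finset.Icc (j - P) b, A.1 i k * B.1 k l * C.1 l j := by
    intro k hk
    rw [Finset.mem_Icc] at hk
    rw [mul_entry, mul_entry_eq_sum hM hP (a := j - P) (b := b) le_rfl (by omega),
      Finset.mul_sum]
    exact Finset.sum_congr rfl fun l _ => (mul_assoc _ _ _).symm
  rw [Finset.sum_congr rfl h1, Finset.sum_congr rfl h2, Finset.sum_comm]

protected theorem one_mul (A : BandMat R) : 1 * A = A := by
  refine ext' fun i j => ?_
  rw [mul_entry, finsum_eq_single _ i]
  · rw [one_entry, if_pos rfl, _root_.one_mul]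
  · intro k hk
    rw [one_entry, if_neg (Ne.symm hk), zero_mul]

protected theorem mul_one (A : BandMat R) : A * 1 = A := by
  refine ext' fun i j => ?_
  rw [mul_entry, finsum_eq_single _ j]
  · rw [one_entry, if_pos rfl, _root_.mul_one]
  · intro k hk
    rw [one_entry, if_neg hk, mul_zero]

protected theorem left_distrib (A B C : BandMat R) : A * (B + C) = A * B + A * C := by
  obtain ⟨N, hN⟩ := A.2
  obtain ⟨M, hM⟩ := B.2
  obtain ⟨P, hP⟩ := C.2
  obtain ⟨Q, hQ⟩ := (B + C).2
  refine ext' fun i j => ?_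
  have e1 := mul_entry_eq_sum (a := min (j - M) (min (j - P) (j - Q))) hN hM (i := i) (j := j)
    (min_le_left _ _) le_rfl
  have e2 := mul_entry_eq_sum (a := min (j - M) (min (j - P) (j - Q))) hN hP (i := i) (j := j)
    ((min_le_right _ _).trans (min_le_left _ _)) le_rfl
  have e3 := mul_entry_eq_sum (a := min (j - M) (min (j - P) (j - Q))) hN hQ (i := i) (j := j)
    ((min_le_right _ _).trans (min_le_right _ _)) le_rfl
  rw [add_entry, mul_entry, mul_entry, mul_entry, e1, e2, e3, ← Finset.sum_add_distrib]
  exact Finset.sum_congr rfl fun k _ => by rw [add_entry, mul_add]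

protected theorem right_distrib (A B C : BandMat R) : (A + B) * C = A * C + B * C := by
  obtain ⟨N, hN⟩ := A.2
  obtain ⟨M, hM⟩ := B.2
  obtain ⟨P, hP⟩ := C.2
  obtain ⟨Q, hQ⟩ := (A + B).2
  refine ext' fun i j => ?_
  have e1 := mul_entry_eq_sum (b := max (i + N) (max (i + M) (i + Q))) hN hP (i := i) (j := j)
    le_rfl (le_max_left _ _)
  have e2 := mul_entry_eq_sum (b := max (i + N) (max (i + M) (i + Q))) hM hP (i := i) (j := j)
    le_rfl ((le_max_left _ _).trans (le_max_right _ _))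
  have e3 := mul_entry_eq_sum (b := max (i + N) (max (i + M) (i + Q))) hQ hP (i := i) (j := j)
    le_rfl ((le_max_right _ _).trans (le_max_right _ _))
  rw [add_entry, mul_entry, mul_entry, mul_entry, e1, e2, e3, ← Finset.sum_add_distrib]
  exact Finset.sum_congr rfl fun k _ => by rw [add_entry, add_mul]

protected theorem zero_mul (A : BandMat R) : 0 * A = 0 := by
  have h := BandMat.right_distrib 0 0 A
  rw [add_zero] at h
  exact left_eq_add.mp h

protected theorem mul_zero (A : BandMat R) : A * 0 = 0 := by
  have h := BandMat.left_distrib A 0 0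
  rw [add_zero] at h
  exact left_eq_add.mp h

noncomputable instance : Ring (BandMat R) where
  mul_assoc := BandMat.mul_assoc
  one_mul := BandMat.one_mul
  mul_one := BandMat.mul_one
  left_distrib := BandMat.left_distrib
  right_distrib := BandMat.right_distrib
  zero_mul := BandMat.zero_mul
  mul_zero := BandMat.mul_zero
  neg_add_cancel := neg_add_cancel
  sub_eq_add_neg := sub_eq_add_neg
  nsmul := fun n A => n • A
  nsmul_zero := fun A => zero_nsmul A
  nsmul_succ := fun n A => succ_nsmul A n
  zsmul := fun n A => n • A
  zsmul_zero' := fun A => zero_zsmul A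
  zsmul_succ' := SubNegMonoid.zsmul_succ'
  zsmul_neg' := SubNegMonoid.zsmul_neg'

/-- The upper triangular part `A₊ = ∑_{j ≥ 0} a_j(s) Λ^j`. -/
def plus (A : BandMat R) : BandMat R :=
  ⟨Matrix.of fun i j => if i ≤ j then A.1 i j else 0, by
    obtain ⟨N, hN⟩ := A.2
    exact ⟨N, fun i j h => by rw [Matrix.of_apply, hN i j h, ite_self]⟩⟩

/-- Apply an additive map to every entry. -/
def mapEntries (φ : R →+ S) (A : BandMat R) : BandMat S :=
  ⟨Matrix.of fun i j => φ (A.1 i j), by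
    obtain ⟨N, hN⟩ := A.2
    exact ⟨N, fun i j h => by rw [Matrix.of_apply, hN i j h, map_zero]⟩⟩

/-- `A = ∑_{j=0}^n a_j(s) Λ^j` with `a_n(s) = 1`. -/
def IsMonicUpper (n : ℕ) (A : BandMat R) : Prop :=
  (∀ j s : ℤ, j < 0 ∨ (n : ℤ) < j → A.coeff j s = 0) ∧ ∀ s : ℤ, A.coeff n s = 1

/-- `A = ∑_{j ≥ 0} u_{1-j}(s) Λ^{1-j}` with `u_1(s) = 1`. -/
def IsLaxForm (A : BandMat R) : Prop :=
  (∀ j s : ℤ, 1 < j → A.coeff j s = 0) ∧ ∀ s : ℤ, A.coeff 1 s = 1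

end BandMat

/-- The ring `𝒜[[t₁, t₂, …]]` of formal power series in infinitely many times. -/
abbrev TimeSeries (A : Type*) [CommRing A] : Type _ := MvPowerSeries ℕ+ A

section Times

variable {A : Type*} [CommRing A]

/-- `∂/∂t_n` on `𝒜[[t₁, t₂, …]]`. -/
noncomputable def dt (n : ℕ+) : TimeSeries A →+ TimeSeries A :=
  (MvPowerSeries.pderiv A n : TimeSeries A →ₗ[A] TimeSeries A).toAddMonoidHom

/-- `∂/∂t_n` on matrices, entry by entry. -/
noncomputable def matDt (n : ℕ+) : BandMat (TimeSeries A) → BandMat (TimeSeries A) :=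
  BandMat.mapEntries (dt n)

/-- `L` is a Lax operator of the matrix mKP hierarchy: it has the form `Λ + u_0(s) + ⋯` and
`∂L/∂t_n = [(L^n)₊, L]` for all `n ≥ 1`. -/
def IsMKPLax (L : BandMat (TimeSeries A)) : Prop :=
  L.IsLaxForm ∧ ∀ n : ℕ+, matDt n L = ⁅(L ^ (n : ℕ)).plus, L⁆

/-- `τ_n = t_n + O(t_{n+1}, t_{n+2}, …)`: the difference `τ_n - t_n` is a power series without
constant term in the variables `t_{n+1}, t_{n+2}, …` only. -/
def IsTriangular (τ : ℕ+ → TimeSeries A) : Prop :=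
  ∀ (n : ℕ+) (d : ℕ+ →₀ ℕ), MvPowerSeries.coeff d (τ n - MvPowerSeries.X n) ≠ 0 →
    d ≠ 0 ∧ ∀ i ∈ d.support, n < i

theorem IsTriangular.hasSubst {τ : ℕ+ → TimeSeries A} (h : IsTriangular τ) :
    MvPowerSeries.HasSubst τ where
  const_coeff n := by
    have h0 : MvPowerSeries.coeff 0 (τ n - MvPowerSeries.X n) = 0 := by
      by_contra hne
      exact (h n 0 hne).1 rfl
    have h1 : MvPowerSeries.constantCoeff (τ n) = 0 := by
      simpa using h0
    rw [h1]
    exact IsNilpotent.zero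
  coeff_zero d := by
    classical
    by_cases hd : d = 0
    · subst hd
      convert Set.finite_empty (α := ℕ+)
      ext n
      simp only [Set.mem_ofPred_eq, Set.mem_empty_iff_false, iff_false, not_not]
      by_contra hne
      refine (h n 0 ?_).1 rfl
      simpa using hne
    · obtain ⟨i, hi⟩ := Finsupp.support_nonempty_iff.mpr hd
      refine (Set.finite_Iic i).subset fun n hn => ?_
      rw [Set.mem_Iic]
      by_contra hlt
      rw [not_le] at hlt
      apply hn
      have h1 : MvPowerSeries.coeff d (MvPowerSeries.X n : TimeSeries A) = 0 := by
        rw [MvPowerSeries.coeff_X, if_neg]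
        rintro rfl
        rw [Finsupp.mem_support_iff, Finsupp.single_apply] at hi
        exact hi (if_neg hlt.ne')
      by_contra hne
      have h2 := (h n d (by rwa [map_sub, h1, sub_zero])).2 i hi
      exact absurd h2 (not_lt.mpr hlt.le)

/-- A triangular formal change of the time variables: `new n` is `t̃_n` as a power series in `t`,
`old n` is `t_n` as a power series in `t̃`, and the two substitutions are inverse to each other. -/
structure TimeChange (A : Type*) [CommRing A] where
  new : ℕ+ → TimeSeries A
  old : ℕ+ → TimeSeries A
  new_triangular : IsTriangular new
  old_triangular : IsTriangular old
  new_old : ∀ n, MvPowerSeries.subst old (new n) = MvPowerSeries.X n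
  old_new : ∀ n, MvPowerSeries.subst new (old n) = MvPowerSeries.X n

namespace TimeChange

/-- Rewrite a function of `t` as a function of `t̃`. -/
noncomputable def toNew (c : TimeChange A) : TimeSeries A →+ TimeSeries A :=
  (MvPowerSeries.substAlgHom (R := A) c.old_triangular.hasSubst : _ →ₐ[A] _).toAddMonoidHom

/-- Rewrite a function of `t̃` as a function of `t`. -/
noncomputable def toOld (c : TimeChange A) : TimeSeries A →+ TimeSeries A :=
  (MvPowerSeries.substAlgHom (R := A) c.new_triangular.hasSubst : _ →ₐ[A] _).toAddMonoidHom

/-- `∂/∂t̃_n` acting on functions of `t`. -/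
noncomputable def dtNew (c : TimeChange A) (n : ℕ+) : TimeSeries A →+ TimeSeries A :=
  c.toOld.comp ((dt n).comp c.toNew)

end TimeChange

end Times

/-! Put D_m = ∂/∂t_m - ad B_m. The Zakharov–Shabat equations make the D_m commute (`covDt_comm`),
and the first claim asks for L = Λ + ⋯ killed by all of them. Filter matrices by their order in Λ.
If X has order at most p with coefficient x(s) there, D_m X has order at most m + p, with
coefficient x(s) - x(s+m) there. If that coefficient vanishes for all large m, x has two consecutive
periods and is constant along the diagonal (`coeff_eq_coeff_zero_of_covDt`).

Existence takes two approximations. First Λ is corrected by terms x(s)Λ^{-n} to a P for which every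
[B_m, P] has order at most 0. At each stage the leading coefficients form a cocycle for the shifts,
by the Jacobi identity. It is a coboundary up to constants (`exists_coboundary`), and the constants
vanish because, for a suitable N, B_N is a polynomial in P up to order 0 while [B_m, B_N] has order
below m. Next, if the orders of all D_m X are bounded together, D_l acts on the leading coefficient
of X as ∂/∂t_l (`BoundedCovDt.covDt_top`). So the leading coefficients of the errors D_m L are a
closed family, and their potential (`exists_dt_eq`) gives the next correction of L (`exists_lax`).

Given L, each B_n equals ∑ a_{n,j} L^j up to negative order, with a_{n,j} independent of s. Since
powers of L commute and are killed by D_m, the nonnegative orders of the Zakharov–Shabat equations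
read ∂a_{n,j}/∂t_m = ∂a_{m,j}/∂t_n (`exists_coefficients`). The potentials of these families are the
new times for j ≥ 1 and f₀ for j = 0. The change is triangular because a_{n,n} = 1 and a_{n,j} = 0
for j > n. Upper triangular parts give the formula for B_n, and the chain rule then gives the Lax
equations. -/

namespace BandMat

/-! ### The order filtration, limits and inverses of band matrices. -/

variable {R S : Type*} [CommRing R] [CommRing S]

theorem ext_coeff {X Y : BandMat R} (h : ∀ j s, X.coeff j s = Y.coeff j s) : X = Y :=
  ext' fun i j => by simpa [coeff] using h (j - i) i

@[simp] theorem coeff_add (X Y : BandMat R) (j s : ℤ) :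
    (X + Y).coeff j s = X.coeff j s + Y.coeff j s := rfl

@[simp] theorem coeff_sub (X Y : BandMat R) (j s : ℤ) :
    (X - Y).coeff j s = X.coeff j s - Y.coeff j s := rfl

@[simp] theorem coeff_neg (X : BandMat R) (j s : ℤ) : (-X).coeff j s = -X.coeff j s := rfl

@[simp] theorem coeff_zero (j s : ℤ) : (0 : BandMat R).coeff j s = 0 := rfl

@[simp] theorem coeff_smul (c : R) (X : BandMat R) (j s : ℤ) :
    (c • X).coeff j s = c * X.coeff j s := rfl

theorem coeff_one (j s : ℤ) : (1 : BandMat R).coeff j s = if j = 0 then 1 else 0 := by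
  rw [coeff, one_entry]
  exact if_congr (by omega) rfl rfl

@[simp] theorem coeff_plus (X : BandMat R) (j s : ℤ) :
    X.plus.coeff j s = if 0 ≤ j then X.coeff j s else 0 :=
  if_congr (by omega) rfl rfl

@[simp] theorem coeff_mapEntries (φ : R →+ S) (X : BandMat R) (j s : ℤ) :
    (X.mapEntries φ).coeff j s = φ (X.coeff j s) := rfl

@[simp] theorem coeff_sum {ι : Type*} (t : Finset ι) (X : ι → BandMat R) (j s : ℤ) :
    (∑ i ∈ t, X i).coeff j s = ∑ i ∈ t, (X i).coeff j s := by
  classical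
  induction t using Finset.induction_on with
  | empty => rfl
  | insert a t ha ih => rw [Finset.sum_insert ha, Finset.sum_insert ha, coeff_add, ih]

/-- `X` has order at most `p` in `Λ`. -/
def OrdLE (X : BandMat R) (p : ℤ) : Prop := ∀ j s : ℤ, p < j → X.coeff j s = 0

theorem exists_ordLE (X : BandMat R) : ∃ p, X.OrdLE p := by
  obtain ⟨N, hN⟩ := X.2
  exact ⟨N, fun j s h => hN _ _ (by omega)⟩

theorem OrdLE.entry {X : BandMat R} {p : ℤ} (h : X.OrdLE p) (i j : ℤ) (hij : i + p < j) :
    X.1 i j = 0 := by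
  simpa [coeff] using h (j - i) i (by omega)

theorem OrdLE.mono {X : BandMat R} {p q : ℤ} (h : X.OrdLE p) (hpq : p ≤ q) : X.OrdLE q :=
  fun j s hj => h j s (by omega)

theorem OrdLE.zero (p : ℤ) : (0 : BandMat R).OrdLE p := fun _ _ _ => rfl

theorem OrdLE.one : (1 : BandMat R).OrdLE 0 := fun j s hj => by
  rw [coeff_one, if_neg (by omega)]

theorem OrdLE.add {X Y : BandMat R} {p : ℤ} (hX : X.OrdLE p) (hY : Y.OrdLE p) :
    (X + Y).OrdLE p := fun j s h => by rw [coeff_add, hX j s h, hY j s h, add_zero]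

theorem OrdLE.sub {X Y : BandMat R} {p : ℤ} (hX : X.OrdLE p) (hY : Y.OrdLE p) :
    (X - Y).OrdLE p := fun j s h => by rw [coeff_sub, hX j s h, hY j s h, sub_zero]

theorem OrdLE.neg {X : BandMat R} {p : ℤ} (hX : X.OrdLE p) : (-X).OrdLE p := fun j s h => by
  rw [coeff_neg, hX j s h, neg_zero]

theorem OrdLE.smul {X : BandMat R} {p : ℤ} (c : R) (hX : X.OrdLE p) : (c • X).OrdLE p :=
  fun j s h => by rw [coeff_smul, hX j s h, mul_zero]

theorem OrdLE.mapEntries {X : BandMat R} {p : ℤ} (φ : R →+ S) (hX : X.OrdLE p) :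
    (X.mapEntries φ).OrdLE p := fun j s h => by rw [coeff_mapEntries, hX j s h, map_zero]

theorem OrdLE.pred {X : BandMat R} {p : ℤ} (hX : X.OrdLE p) (h0 : ∀ s, X.coeff p s = 0) :
    X.OrdLE (p - 1) := fun j s hj => by
  rcases eq_or_lt_of_le (show p ≤ j by omega) with rfl | h
  · exact h0 s
  · exact hX j s h

theorem eq_zero_of_ordLE {X : BandMat R} (h : ∀ n : ℕ, ∃ p : ℤ, p ≤ -n ∧ X.OrdLE p) : X = 0 :=
  ext_coeff fun j s => by
    obtain ⟨p, hp, hX⟩ := h (-j + 1).toNat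
    exact hX j s (by omega)

theorem OrdLE.mul {X Y : BandMat R} {p q : ℤ} (hX : X.OrdLE p) (hY : Y.OrdLE q) :
    (X * Y).OrdLE (p + q) := fun j s h => by
  rw [coeff, mul_entry, mul_entry_eq_sum hX.entry hY.entry le_rfl le_rfl,
    Finset.Icc_eq_empty (by omega), Finset.sum_empty]

theorem coeff_mul_top {X Y : BandMat R} {p q : ℤ} (hX : X.OrdLE p) (hY : Y.OrdLE q) (s : ℤ) :
    (X * Y).coeff (p + q) s = X.coeff p s * Y.coeff q (s + p) := by
  rw [coeff, mul_entry, mul_entry_eq_sum hX.entry hY.entry le_rfl le_rfl,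
    show s + (p + q) - q = s + p by ring, Finset.Icc_self, Finset.sum_singleton, coeff, coeff,
    add_assoc]

theorem OrdLE.lie {X Y : BandMat R} {p q : ℤ} (hX : X.OrdLE p) (hY : Y.OrdLE q) :
    ⁅X, Y⁆.OrdLE (p + q) := by
  rw [Ring.lie_def]
  exact (hX.mul hY).sub ((hY.mul hX).mono (by omega))

theorem coeff_lie_top {X Y : BandMat R} {p q : ℤ} (hX : X.OrdLE p) (hY : Y.OrdLE q) (s : ℤ) :
    ⁅X, Y⁆.coeff (p + q) s =
      X.coeff p s * Y.coeff q (s + p) - Y.coeff q s * X.coeff p (s + q) := by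
  rw [Ring.lie_def, coeff_sub, coeff_mul_top hX hY, add_comm p q, coeff_mul_top hY hX]

theorem mul_entry_support_finite (X Y : BandMat R) (i j : ℤ) :
    (Function.support fun k => X.1 i k * Y.1 k j).Finite := by
  obtain ⟨p, hp⟩ := X.2
  obtain ⟨q, hq⟩ := Y.2
  refine (Set.finite_Icc (j - q) (i + p)).subset fun k hk => ?_
  rw [Function.mem_support] at hk
  rw [Set.mem_Icc]
  by_contra hcon
  apply hk
  by_cases h : i + p < k
  · rw [hp i k h, zero_mul]
  · rw [hq k j (by omega), mul_zero]

instance : IsScalarTower R (BandMat R) (BandMat R) where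
  smul_assoc c X Y := ext' fun i j => by
    rw [smul_eq_mul, smul_eq_mul, smul_entry, mul_entry, mul_entry, mul_finsum']
    · exact finsum_congr fun k => by rw [smul_entry, mul_assoc]
    · exact mul_entry_support_finite X Y i j

instance : SMulCommClass R (BandMat R) (BandMat R) where
  smul_comm c X Y := ext' fun i j => by
    rw [smul_eq_mul, smul_eq_mul, smul_entry, mul_entry, mul_entry, mul_finsum']
    · exact finsum_congr fun k => by rw [smul_entry, mul_left_comm]
    · exact mul_entry_support_finite X Y i j

theorem lie_add' (X Y Z : BandMat R) : ⁅X, Y + Z⁆ = ⁅X, Y⁆ + ⁅X, Z⁆ := by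
  simp only [Ring.lie_def]; noncomm_ring

theorem lie_sub' (X Y Z : BandMat R) : ⁅X, Y - Z⁆ = ⁅X, Y⁆ - ⁅X, Z⁆ := by
  simp only [Ring.lie_def]; noncomm_ring

theorem add_lie' (X Y Z : BandMat R) : ⁅X + Y, Z⁆ = ⁅X, Z⁆ + ⁅Y, Z⁆ := by
  simp only [Ring.lie_def]; noncomm_ring

theorem lie_smul' (c : R) (X Y : BandMat R) : ⁅X, c • Y⁆ = c • ⁅X, Y⁆ := by
  rw [Ring.lie_def, Ring.lie_def, mul_smul_comm, smul_mul_assoc, smul_sub]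

theorem smul_lie' (c : R) (X Y : BandMat R) : ⁅c • X, Y⁆ = c • ⁅X, Y⁆ := by
  rw [Ring.lie_def, Ring.lie_def, mul_smul_comm, smul_mul_assoc, smul_sub]

theorem mapEntries_add (φ : R →+ S) (X Y : BandMat R) :
    (X + Y).mapEntries φ = X.mapEntries φ + Y.mapEntries φ :=
  ext' fun _ _ => map_add φ _ _

theorem mapEntries_sub (φ : R →+ S) (X Y : BandMat R) :
    (X - Y).mapEntries φ = X.mapEntries φ - Y.mapEntries φ :=
  ext' fun _ _ => map_sub φ _ _

/-- The matrix `x(s) Λ^j`. -/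
def single (x : ℤ → R) (j : ℤ) : BandMat R :=
  ⟨Matrix.of fun i k => if k = i + j then x i else 0,
    j, fun i k h => by rw [Matrix.of_apply, if_neg (by omega)]⟩

theorem coeff_single (x : ℤ → R) (j k s : ℤ) :
    (single x j).coeff k s = if k = j then x s else 0 :=
  if_congr (by omega) rfl rfl

theorem OrdLE.single (x : ℤ → R) (j : ℤ) : (single x j).OrdLE j := fun k s h => by
  rw [coeff_single, if_neg (by omega)]

/-- A sequence of matrices whose successive differences have order tending to `-∞` converges. -/
theorem exists_limit (Z : ℕ → BandMat R) (hZ : ∀ n : ℕ, (Z (n + 1) - Z n).OrdLE (-n)) :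
    ∃ W : BandMat R, ∀ n : ℕ, (W - Z n).OrdLE (-n) := by
  have key : ∀ n k : ℕ, (Z (n + k) - Z n).OrdLE (-n) := by
    intro n k
    induction k with
    | zero => rw [add_zero, sub_self]; exact OrdLE.zero _
    | succ k ih =>
      have := ((hZ (n + k)).mono (q := -n) (by push_cast; omega)).add ih
      rwa [sub_add_sub_cancel, add_assoc] at this
  obtain ⟨p, hp⟩ := exists_ordLE (Z 0)
  -- The diagonal k = j - i no longer changes from index 1 - k on (index 0 if k ≥ 1), so its entries
  -- are read off there.
  refine ⟨⟨Matrix.of fun i j => (Z (i - j + 1).toNat).1 i j, max p 0, fun i j h => ?_⟩,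
    fun n j s hj => ?_⟩
  · rw [Matrix.of_apply, show (i - j + 1).toNat = 0 by omega]
    exact hp.entry i j (by omega)
  · rw [coeff_sub, sub_eq_zero]
    change (Z (s - (s + j) + 1).toNat).coeff j s = _
    have h1 : (s - (s + j) + 1).toNat ≤ n := by omega
    obtain ⟨k, rfl⟩ := Nat.exists_eq_add_of_le h1
    have := key (s - (s + j) + 1).toNat k j s (by omega)
    rw [coeff_sub, sub_eq_zero] at this
    exact this.symm

/-- `X = Λ^p + (lower order terms)`. -/
def IsMonic (X : BandMat R) (p : ℤ) : Prop := X.OrdLE p ∧ ∀ s, X.coeff p s = 1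

theorem IsMonic.one : (1 : BandMat R).IsMonic 0 :=
  ⟨OrdLE.one, fun s => by rw [coeff_one, if_pos rfl]⟩

theorem IsMonic.mul {X Y : BandMat R} {p q : ℤ} (hX : X.IsMonic p) (hY : Y.IsMonic q) :
    (X * Y).IsMonic (p + q) :=
  ⟨hX.1.mul hY.1, fun s => by rw [coeff_mul_top hX.1 hY.1, hX.2, hY.2, mul_one]⟩

theorem IsMonic.ordLE_lie {X Y : BandMat R} {p q : ℤ} (hX : X.IsMonic p) (hY : Y.IsMonic q) :
    ⁅X, Y⁆.OrdLE (p + q - 1) :=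
  (hX.1.lie hY.1).pred fun s => by
    rw [coeff_lie_top hX.1 hY.1, hX.2, hY.2, hX.2, hY.2, sub_self]

theorem IsMonic.pow {X : BandMat R} {p : ℤ} (hX : X.IsMonic p) (k : ℕ) :
    (X ^ k).IsMonic (k * p) := by
  induction k with
  | zero => simpa using IsMonic.one
  | succ k ih =>
    rw [pow_succ, show ((k + 1 : ℕ) : ℤ) * p = k * p + p by push_cast; ring]
    exact ih.mul hX

theorem IsMonic.single (p : ℤ) : (single (fun _ => (1 : R)) p).IsMonic p :=
  ⟨OrdLE.single _ _, fun s => by rw [coeff_single, if_pos rfl]⟩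

theorem IsMonic.add {X Y : BandMat R} {p q : ℤ} (hX : X.IsMonic p) (hY : Y.OrdLE q)
    (hq : q < p) : (X + Y).IsMonic p :=
  ⟨hX.1.add (hY.mono hq.le), fun s => by rw [coeff_add, hX.2, hY _ _ hq, add_zero]⟩

theorem OrdLE.pow {X : BandMat R} {p : ℤ} (hX : X.OrdLE p) (k : ℕ) : (X ^ k).OrdLE (k * p) := by
  induction k with
  | zero => simpa using OrdLE.one
  | succ k ih =>
    rw [pow_succ, show ((k + 1 : ℕ) : ℤ) * p = k * p + p by push_cast; ring]
    exact ih.mul hX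

/-- Neumann series: Λ^{-p} X = 1 - N with N of negative order, so the partial sums of ∑ N^k
converge. -/
theorem IsMonic.exists_left_inverse {X : BandMat R} {p : ℤ} (hX : X.IsMonic p) :
    ∃ Y : BandMat R, Y.IsMonic (-p) ∧ Y * X = 1 := by
  set E : BandMat R := BandMat.single (fun _ => (1 : R)) (-p)
  have hE : E.IsMonic (-p) := IsMonic.single _
  have hV : (E * X).IsMonic 0 := by simpa using hE.mul hX
  set N : BandMat R := 1 - E * X with hN
  have hN1 : N.OrdLE (-1) :=
    (OrdLE.one.sub hV.1).pred fun s => by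
      rw [coeff_sub, IsMonic.one.2, hV.2, sub_self]
  have hNk : ∀ k : ℕ, (N ^ k).OrdLE (-k) := fun k => by simpa using hN1.pow k
  obtain ⟨W, hW⟩ := exists_limit (fun n => ∑ k ∈ Finset.range n, N ^ k) fun n => by
    rw [Finset.sum_range_succ, add_sub_cancel_left]
    exact hNk n
  have hWV : W * (E * X) = 1 := by
    rw [← sub_eq_zero]
    refine eq_zero_of_ordLE fun n => ⟨-n, le_rfl, ?_⟩
    have h1 : W * (E * X) - 1 =
        (W - ∑ k ∈ Finset.range n, N ^ k) * (E * X) - N ^ n := by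
      have h2 : (∑ k ∈ Finset.range n, N ^ k) * (E * X) = 1 - N ^ n := by
        rw [← geom_sum_mul_neg, hN, sub_sub_cancel]
      rw [sub_mul, h2]
      abel
    rw [h1]
    have h3 := (hW n).mul hV.1
    rw [add_zero] at h3
    exact h3.sub (hNk n)
  refine ⟨W * E, ?_, by rw [mul_assoc, hWV]⟩
  have hW1 : W.IsMonic 0 := by
    have h1 := hW 1
    rw [Finset.sum_range_one, pow_zero] at h1
    have h2 := IsMonic.one.add h1 (by norm_num)
    rwa [add_sub_cancel] at h2
  simpa using hW1.mul hE

theorem IsMonic.exists_inverse {X : BandMat R} {p : ℤ} (hX : X.IsMonic p) :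
    ∃ Y : BandMat R, Y.IsMonic (-p) ∧ Y * X = 1 ∧ X * Y = 1 := by
  obtain ⟨Y, hY, hYX⟩ := hX.exists_left_inverse
  obtain ⟨Z, -, hZY⟩ := hY.exists_left_inverse
  refine ⟨Y, hY, hYX, ?_⟩
  have : Z = X := by rw [← mul_one Z, ← hYX, ← mul_assoc, hZY, one_mul]
  rw [← this, hZY]

end BandMat

/-! ### The commuting covariant derivatives D_n. -/

section CovariantDerivative

open BandMat

variable {A : Type*} [CommRing A]

theorem dt_mul (n : ℕ+) (f g : TimeSeries A) : dt n (f * g) = f * dt n g + g * dt n f :=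
  (MvPowerSeries.pderiv A n).leibniz f g

theorem coeff_dt (n : ℕ+) (f : TimeSeries A) (d : ℕ+ →₀ ℕ) :
    MvPowerSeries.coeff d (dt n f) =
      MvPowerSeries.coeff (d + Finsupp.single n 1) f * (d n + 1) :=
  MvPowerSeries.coeff_pderiv f d

theorem dt_comm (m n : ℕ+) (f : TimeSeries A) : dt m (dt n f) = dt n (dt m f) := by
  ext d
  by_cases h : m = n
  · rw [h]
  · simp only [coeff_dt, Finsupp.add_apply, Finsupp.single_apply, if_neg h, if_neg (Ne.symm h)]
    rw [add_right_comm]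
    push_cast
    ring

theorem dt_one (n : ℕ+) : dt n (1 : TimeSeries A) = 0 := MvPowerSeries.pderiv_one

@[simp] theorem coeff_matDt (n : ℕ+) (X : BandMat (TimeSeries A)) (j s : ℤ) :
    (matDt n X).coeff j s = dt n (X.coeff j s) := rfl

theorem matDt_add (n : ℕ+) (X Y : BandMat (TimeSeries A)) :
    matDt n (X + Y) = matDt n X + matDt n Y := mapEntries_add _ _ _

theorem matDt_sub (n : ℕ+) (X Y : BandMat (TimeSeries A)) :
    matDt n (X - Y) = matDt n X - matDt n Y := mapEntries_sub _ _ _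

theorem matDt_one (n : ℕ+) : matDt n (1 : BandMat (TimeSeries A)) = 0 := ext_coeff fun j s => by
  rw [coeff_matDt, coeff_one, coeff_zero]
  split_ifs
  · exact dt_one n
  · exact map_zero _

theorem matDt_smul (n : ℕ+) (c : TimeSeries A) (X : BandMat (TimeSeries A)) :
    matDt n (c • X) = dt n c • X + c • matDt n X := ext_coeff fun j s => by
  rw [coeff_matDt, coeff_smul, dt_mul, coeff_add, coeff_smul, coeff_smul, coeff_matDt]
  ring

theorem matDt_comm (m n : ℕ+) (X : BandMat (TimeSeries A)) :
    matDt m (matDt n X) = matDt n (matDt m X) := ext_coeff fun j s => by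
  simp only [coeff_matDt]
  exact dt_comm _ _ _

theorem matDt_mul (n : ℕ+) (X Y : BandMat (TimeSeries A)) :
    matDt n (X * Y) = matDt n X * Y + X * matDt n Y := ext' fun i j => by
  rw [add_entry, mul_entry, mul_entry]
  change dt n ((X * Y).1 i j) = _
  rw [mul_entry, AddMonoidHom.map_finsum _ (mul_entry_support_finite X Y i j),
    ← finsum_add_distrib (mul_entry_support_finite _ _ i j) (mul_entry_support_finite _ _ i j)]
  refine finsum_congr fun k => ?_
  rw [dt_mul]
  change _ = dt n (X.1 i k) * Y.1 k j + X.1 i k * dt n (Y.1 k j)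
  ring

theorem BandMat.OrdLE.matDt {X : BandMat (TimeSeries A)} {p : ℤ} (hX : X.OrdLE p) (n : ℕ+) :
    (matDt n X).OrdLE p := hX.mapEntries _

theorem BandMat.IsMonic.ordLE_matDt {X : BandMat (TimeSeries A)} {p : ℤ} (hX : X.IsMonic p)
    (n : ℕ+) : (_root_.matDt n X).OrdLE (p - 1) :=
  (hX.1.matDt n).pred fun s => by rw [coeff_matDt, hX.2, dt_one]

theorem BandMat.IsMonicUpper.isMonic {X : BandMat (TimeSeries A)} {n : ℕ} (h : X.IsMonicUpper n) :
    X.IsMonic n := ⟨fun j s hj => h.1 j s (Or.inr hj), h.2⟩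

/-- `D_n X = ∂X/∂t_n - [B_n, X]`. -/
noncomputable def covDt (B : ℕ+ → BandMat (TimeSeries A)) (n : ℕ+) (X : BandMat (TimeSeries A)) :
    BandMat (TimeSeries A) := matDt n X - ⁅B n, X⁆

variable {B : ℕ+ → BandMat (TimeSeries A)}

theorem covDt_add (n : ℕ+) (X Y : BandMat (TimeSeries A)) :
    covDt B n (X + Y) = covDt B n X + covDt B n Y := by
  simp only [covDt, matDt_add, lie_add']
  abel

theorem covDt_sub (n : ℕ+) (X Y : BandMat (TimeSeries A)) :
    covDt B n (X - Y) = covDt B n X - covDt B n Y := by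
  simp only [covDt, matDt_sub, lie_sub']
  abel

theorem covDt_smul (n : ℕ+) (c : TimeSeries A) (X : BandMat (TimeSeries A)) :
    covDt B n (c • X) = dt n c • X + c • covDt B n X := by
  simp only [covDt, matDt_smul, lie_smul', smul_sub]
  abel

theorem covDt_one (n : ℕ+) : covDt B n 1 = 0 := by
  simp only [covDt, matDt_one, Ring.lie_def, mul_one, one_mul, sub_self]

theorem covDt_mul (n : ℕ+) (X Y : BandMat (TimeSeries A)) :
    covDt B n (X * Y) = covDt B n X * Y + X * covDt B n Y := by
  simp only [covDt, matDt_mul, Ring.lie_def]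
  noncomm_ring

theorem covDt_sum {ι : Type*} (n : ℕ+) (t : Finset ι) (X : ι → BandMat (TimeSeries A)) :
    covDt B n (∑ i ∈ t, X i) = ∑ i ∈ t, covDt B n (X i) :=
  map_sum (AddMonoidHom.mk' (covDt B n) (covDt_add n)) X t

/-- The commutator of D_m and D_n is ad of the left-hand side of the Zakharov–Shabat equation. -/
theorem covDt_comm (hZS : ∀ m n : ℕ+, matDt n (B m) - matDt m (B n) + ⁅B m, B n⁆ = 0)
    (m n : ℕ+) (X : BandMat (TimeSeries A)) :
    covDt B m (covDt B n X) = covDt B n (covDt B m X) := by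
  have h := congrArg (fun Z => ⁅Z, X⁆) (hZS m n)
  rw [← sub_eq_zero, ← (show ⁅(0 : BandMat (TimeSeries A)), X⁆ = 0 by simp [Ring.lie_def]), ← h]
  simp only [covDt, matDt_sub, matDt_mul, Ring.lie_def, matDt_comm m n]
  noncomm_ring

theorem ordLE_covDt (hB : ∀ n : ℕ+, (B n).IsMonicUpper n) (n : ℕ+)
    {X : BandMat (TimeSeries A)} {p : ℤ} (hX : X.OrdLE p) :
    (covDt B n X).OrdLE (n + p) :=
  ((hX.matDt n).mono (by have := n.pos; omega)).sub ((hB n).isMonic.1.lie hX)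

/-- Since n ≥ 1, the term ∂X/∂t_n does not reach order n + p; only the commutator with Λ^n
contributes. -/
theorem coeff_covDt_top (hB : ∀ n : ℕ+, (B n).IsMonicUpper n) (n : ℕ+)
    {X : BandMat (TimeSeries A)} {p : ℤ} (hX : X.OrdLE p) (s : ℤ) :
    (covDt B n X).coeff (n + p) s = X.coeff p s - X.coeff p (s + n) := by
  have h := n.pos
  rw [covDt, coeff_sub, coeff_lie_top (hB n).isMonic.1 hX, (hX.matDt n) _ _ (by omega),
    (hB n).isMonic.2, (hB n).isMonic.2]
  ring

end CovariantDerivative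

/-! ### Difference equations on ℤ. -/

section Differences

variable {R : Type*} [CommRing R]

theorem exists_sub_eq (e : ℤ → R) : ∃ x : ℤ → R, ∀ s, x (s + 1) - x s = e s := by
  -- At most one of the two sums is nonempty: summation from 0 upwards or downwards.
  refine ⟨fun s => ∑ i ∈ Finset.Ico 0 s, e i - ∑ i ∈ Finset.Ico s 0, e i, fun s => ?_⟩
  beta_reduce
  rcases le_or_gt 0 s with h | h
  · rw [Finset.Ico_eq_empty_of_le h, Finset.Ico_eq_empty_of_le (show (0 : ℤ) ≤ s + 1 by omega),
      ← Finset.insert_Ico_right_eq_Ico_add_one h, Finset.sum_insert (by simp)]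
    simp
  · rw [Finset.Ico_eq_empty_of_le h.le, Finset.Ico_eq_empty_of_le (show s + 1 ≤ (0 : ℤ) by omega),
      ← Finset.insert_Ico_add_one_left_eq_Ico h, Finset.sum_insert (by simp)]
    simp

theorem eq_apply_zero_of_forall_add_one {R : Type*} {x : ℤ → R} (h : ∀ s, x (s + 1) = x s)
    (s : ℤ) : x s = x 0 := by
  induction s using Int.induction_on with
  | zero => rfl
  | succ i ih => rw [h, ih]
  | pred i ih => rw [← ih, ← h (-i - 1), sub_add_cancel]

theorem eq_apply_zero_of_periods {R : Type*} {x : ℤ → R} {m : ℤ} (h : ∀ s, x (s + m) = x s)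
    (h' : ∀ s, x (s + (m + 1)) = x s) (s : ℤ) : x s = x 0 :=
  eq_apply_zero_of_forall_add_one (fun s => by rw [← h (s + 1), ← h' s]; ring_nf) s

/-- The condition `hr` is the cocycle condition for shifts by m ≥ N; it determines r as a coboundary
only up to constants such as r m s = m·c. The condition `hy` removes these: summed over N steps, r
is the coboundary of a single function. -/
theorem exists_coboundary {N : ℕ} (hN : ∀ c : R, (N : R) * c = 0 → c = 0) (r : ℕ → ℤ → R)
    (y : ℤ → R)
    (hr : ∀ l m : ℕ, N ≤ l → N ≤ m → ∀ s, r m (s + l) - r m s = r l (s + m) - r l s)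
    (hy : ∀ m : ℕ, N ≤ m → ∀ s, ∑ i ∈ Finset.range N, r m (s + i) + (y (s + m) - y s) = 0) :
    ∃ x : ℤ → R, ∀ m : ℕ, N ≤ m → ∀ s, r m s + (x (s + m) - x s) = 0 := by
  -- This x makes ρ_{N+1}(s) = ρ_N(s+1); the cocycle condition for N and N + 1 then forces ρ_N to be
  -- constant.
  obtain ⟨x, hx⟩ := exists_sub_eq fun s => r N (s + 1) - r (N + 1) s
  refine ⟨x, ?_⟩
  set ρ : ℕ → ℤ → R := fun m s => r m s + (x (s + m) - x s) with hρ
  change ∀ m : ℕ, N ≤ m → ∀ s, ρ m s = 0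
  have coc : ∀ l m : ℕ, N ≤ l → N ≤ m → ∀ s, ρ m (s + l) - ρ m s = ρ l (s + m) - ρ l s := by
    intro l m hl hm s
    have := hr l m hl hm s
    simp only [hρ]
    rw [add_right_comm s (l : ℤ) m]
    linear_combination this
  have hshift : ∀ s, ρ (N + 1) s = ρ N (s + 1) := by
    intro s
    have := hx s
    simp only [hρ]
    push_cast
    rw [add_assoc s 1 (N : ℤ), add_comm (1 : ℤ) N]
    linear_combination this
  have hρN : ∀ s, ρ N (s + 1) = ρ N s := by
    intro s
    have h1 := coc N (N + 1) le_rfl (Nat.le_succ N) s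
    rw [hshift, hshift, show s + ((N + 1 : ℕ) : ℤ) = s + N + 1 by push_cast; ring] at h1
    linear_combination -h1
  have hconstN := eq_apply_zero_of_forall_add_one hρN
  have hconst : ∀ m, N ≤ m → ∀ s, ρ m s = ρ m 0 := by
    intro m hm
    refine eq_apply_zero_of_periods (m := N) (fun s => ?_) (fun s => ?_)
    · have h1 := coc N m le_rfl hm s
      rw [hconstN (s + m), hconstN s, sub_self] at h1
      exact sub_eq_zero.mp h1
    · have h1 := coc (N + 1) m (Nat.le_succ N) hm s
      rw [hshift, hshift, hconstN (s + m + 1), hconstN (s + 1), sub_self] at h1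
      push_cast at h1
      exact sub_eq_zero.mp h1
  set z : ℤ → R := fun s => ∑ i ∈ Finset.range N, x (s + i) - y s with hz
  -- The constants satisfy N ρ_m = z(s+m) - z(s). As ρ_{N+1} = ρ_N, comparing m = N with m = N + 1
  -- makes z constant, hence N ρ_m = 0.
  have hzm : ∀ m, N ≤ m → ∀ s, (N : R) * ρ m 0 = z (s + m) - z s := by
    intro m hm s
    have h1 : ∑ i ∈ Finset.range N, r m (s + i) =
        ∑ i ∈ Finset.range N, (ρ m 0 - (x (s + m + i) - x (s + i))) := by
      refine Finset.sum_congr rfl fun i _ => ?_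
      rw [← hconst m hm (s + i)]
      simp only [hρ]
      rw [add_right_comm s (i : ℤ) m]
      ring
    have h2 := hy m hm s
    rw [h1, Finset.sum_sub_distrib, Finset.sum_sub_distrib, Finset.sum_const, Finset.card_range,
      nsmul_eq_mul] at h2
    simp only [hz]
    linear_combination h2
  have hzconst : ∀ s, z (s + 1) = z s := by
    intro s
    have h1 := hzm (N + 1) (Nat.le_succ N) (s - N)
    have h2 := hzm N le_rfl (s - N)
    rw [hshift, hconstN (0 + 1), h2] at h1
    push_cast at h1
    rw [show s - (N : ℤ) + (N + 1) = s + 1 by ring, sub_add_cancel] at h1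
    linear_combination -h1
  intro m hm s
  rw [hconst m hm s]
  apply hN
  rw [hzm m hm 0, eq_apply_zero_of_forall_add_one hzconst (0 + m), sub_self]

end Differences

/-! ### Expansion in powers of a monic matrix. -/

section Expansion

open BandMat

variable {A : Type*} [CommRing A] {B : ℕ+ → BandMat (TimeSeries A)}

theorem coeff_eq_coeff_zero_of_covDt (hB : ∀ n : ℕ+, (B n).IsMonicUpper n)
    {X : BandMat (TimeSeries A)} {p : ℤ} (hX : X.OrdLE p) (N : ℕ)
    (h : ∀ m : ℕ+, N < m → (covDt B m X).OrdLE (m + p - 1)) (s : ℤ) :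
    X.coeff p s = X.coeff p 0 := by
  have key : ∀ m : ℕ+, N < m → ∀ s, X.coeff p (s + m) = X.coeff p s := by
    intro m hm s
    have h1 := coeff_covDt_top hB m hX s
    rw [h m hm _ _ (by omega)] at h1
    exact (sub_eq_zero.mp h1.symm).symm
  exact eq_apply_zero_of_periods (x := X.coeff p) (m := ((N.succPNat : ℕ) : ℤ))
    (key _ (by simp)) (fun s => by
      have := key (N.succPNat + 1) (by simp) s
      push_cast at this ⊢
      exact this) s

/-- Leading terms are peeled off one at a time. While the order of the remainder is at least q, the
bound on D_m makes its leading coefficient constant along the diagonal, and subtracting that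
multiple of a power of P preserves the bound. -/
theorem exists_expansion (hB : ∀ n : ℕ+, (B n).IsMonicUpper n) {P : BandMat (TimeSeries A)}
    (hP : P.IsMonic 1) (N q p : ℕ)
    (hPN : ∀ c : TimeSeries A, ∀ j < p, ∀ m : ℕ+, N < m →
      (covDt B m (c • P ^ j)).OrdLE (m + q - 1))
    {X : BandMat (TimeSeries A)} (hX : X.OrdLE (p - 1))
    (hXN : ∀ m : ℕ+, N < m → (covDt B m X).OrdLE (m + q - 1)) :
    ∃ a : ℕ → TimeSeries A, (X - ∑ j ∈ Finset.Ico q p, a j • P ^ j).OrdLE (q - 1) := by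
  induction p generalizing X with
  | zero =>
    refine ⟨0, ?_⟩
    rw [Finset.Ico_eq_empty (by omega), Finset.sum_empty, sub_zero]
    exact hX.mono (by push_cast; omega)
  | succ p ih =>
    by_cases hqp : q ≤ p
    · have hX' : X.OrdLE p := hX.mono (by push_cast; omega)
      have hc := coeff_eq_coeff_zero_of_covDt hB hX' N fun m hm => (hXN m hm).mono (by omega)
      have hPp : (P ^ p).IsMonic p := by simpa using hP.pow p
      obtain ⟨a, ha⟩ := ih (X := X - X.coeff p 0 • P ^ p)
        (fun c j hj => hPN c j (by omega))
        ((hX'.sub (hPp.1.smul _)).pred fun s => by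
          rw [coeff_sub, coeff_smul, hPp.2, hc, mul_one, sub_self])
        (fun m hm => by
          rw [covDt_sub]
          exact (hXN m hm).sub (hPN _ p (by omega) m hm))
      refine ⟨Function.update a p (X.coeff p 0), ?_⟩
      rw [Finset.sum_Ico_succ_top hqp, Function.update_self,
        Finset.sum_congr rfl (g := fun j => a j • P ^ j) (fun j hj => by
          rw [Finset.mem_Ico] at hj
          rw [Function.update_of_ne (by omega)])]
      rwa [add_comm, ← sub_sub]
    · refine ⟨0, ?_⟩
      rw [Finset.Ico_eq_empty (by omega), Finset.sum_empty, sub_zero]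
      exact hX.mono (by push_cast; omega)

theorem eq_one_of_expansion {P X : BandMat (TimeSeries A)} (hP : P.IsMonic 1) {q N : ℕ}
    (hq : q ≤ N) (hX : X.IsMonic N) {a : ℕ → TimeSeries A}
    (ha : (X - ∑ j ∈ Finset.Ico q (N + 1), a j • P ^ j).OrdLE (q - 1)) : a N = 1 := by
  have hPj : ∀ j : ℕ, (P ^ j).IsMonic j := fun j => by simpa using hP.pow j
  have h := ha N 0 (by omega)
  rw [coeff_sub, hX.2, Finset.sum_Ico_succ_top hq, coeff_add, coeff_sum,
    Finset.sum_eq_zero (fun j hj => by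
      rw [Finset.mem_Ico] at hj
      rw [coeff_smul, (hPj j).1 _ _ (by omega), mul_zero]), coeff_smul, (hPj N).2] at h
  linear_combination -h

end Expansion

/-! ### A matrix that nearly commutes with all B_m. -/

section ApproximateCommutant

open BandMat

variable {A : Type*} [CommRing A] {B : ℕ+ → BandMat (TimeSeries A)}

theorem covDt_eq_matDt (hZS : ∀ m n : ℕ+, matDt n (B m) - matDt m (B n) + ⁅B m, B n⁆ = 0)
    (m n : ℕ+) : covDt B m (B n) = matDt n (B m) := by
  rw [covDt, ← sub_eq_zero, ← neg_eq_zero, ← hZS m n]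
  abel

/-- The commutator is a difference of derivatives of monic matrices, and differentiation kills their
leading terms. -/
theorem ordLE_lie_of_zakharovShabat (hB : ∀ n : ℕ+, (B n).IsMonicUpper n)
    (hZS : ∀ m n : ℕ+, matDt n (B m) - matDt m (B n) + ⁅B m, B n⁆ = 0)
    (m n : ℕ+) : ⁅B m, B n⁆.OrdLE (max (m : ℤ) n - 1) := by
  have h : ⁅B m, B n⁆ = matDt m (B n) - matDt n (B m) := by
    rw [← covDt_eq_matDt hZS m n, covDt]
    abel
  rw [h]
  exact (((hB n).isMonic.ordLE_matDt m).mono (by omega)).sub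
    (((hB m).isMonic.ordLE_matDt n).mono (by omega))

/-- By the Leibniz rule each of the k + 1 factors P contributes the coefficient of [Q, P], shifted
by the number of factors in front of it. -/
theorem lie_pow_succ {R : Type*} [CommRing R] {Q P : BandMat R} {d : ℤ} (hP : P.IsMonic 1)
    (hQ : ⁅Q, P⁆.OrdLE d) (k : ℕ) :
    ⁅Q, P ^ (k + 1)⁆.OrdLE (k + d) ∧ ∀ s, ⁅Q, P ^ (k + 1)⁆.coeff (k + d) s =
      ∑ i ∈ Finset.range (k + 1), ⁅Q, P⁆.coeff d (s + i) := by
  induction k with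
  | zero => simpa using hQ
  | succ k ih =>
    have hPk : (P ^ (k + 1)).IsMonic (k + 1) := by simpa using hP.pow (k + 1)
    have h : ⁅Q, P ^ (k + 1 + 1)⁆ = ⁅Q, P ^ (k + 1)⁆ * P + P ^ (k + 1) * ⁅Q, P⁆ := by
      rw [pow_succ P (k + 1), Ring.lie_def, Ring.lie_def, Ring.lie_def]
      noncomm_ring
    have e1 : ((k + 1 : ℕ) : ℤ) + d = k + d + 1 := by push_cast; ring
    have e2 : ((k + 1 : ℕ) : ℤ) + d = k + 1 + d := by push_cast; ring
    rw [h]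
    refine ⟨?_, fun s => ?_⟩
    · refine OrdLE.add ?_ ?_
      · rw [e1]; exact ih.1.mul hP.1
      · rw [e2]; exact hPk.1.mul hQ
    · rw [coeff_add]
      nth_rewrite 1 [e1]
      rw [coeff_mul_top ih.1 hP.1, e2, coeff_mul_top hPk.1 hQ, hP.2, hPk.2, ih.2,
        Finset.sum_range_succ _ (k + 1)]
      push_cast
      ring

/-- Adding x(s)Λ^{-n} to P changes the coefficient of [B_m, P] at order m - n by x(s+m) - x(s). One
x has to cancel that coefficient for all m > n at once, which is the problem solved by
`exists_coboundary` with N = n + 1. -/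
theorem exists_step_approximateCommutant [Algebra ℚ A] (hB : ∀ n : ℕ+, (B n).IsMonicUpper n)
    (hZS : ∀ m n : ℕ+, matDt n (B m) - matDt m (B n) + ⁅B m, B n⁆ = 0) (n : ℕ)
    {P : BandMat (TimeSeries A)} (hP : P.IsMonic 1)
    (hBP : ∀ m : ℕ+, ⁅B m, P⁆.OrdLE (max 0 (m - n))) :
    ∃ P' : BandMat (TimeSeries A), P'.IsMonic 1 ∧
      (∀ m : ℕ+, ⁅B m, P'⁆.OrdLE (max 0 (m - (n + 1 : ℕ)))) ∧ (P' - P).OrdLE (-n) := by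
  set N : ℕ+ := n.succPNat with hN
  have hNn : (N : ℕ) = n + 1 := rfl
  have hPj : ∀ j : ℕ, (P ^ j).IsMonic j := fun j => by simpa using hP.pow j
  have hBP' : ∀ m : ℕ+, N ≤ m → ⁅B m, P⁆.OrdLE (m - n) := fun m hm => by
    have : (N : ℕ) ≤ m := hm
    exact (hBP m).mono (by omega)
  have hlie : ∀ m : ℕ+, N ≤ m → ∀ k : ℕ, ⁅B m, P ^ (k + 1)⁆.OrdLE (k + (m - n)) :=
    fun m hm k => (lie_pow_succ hP (hBP' m hm) k).1
  -- Here D_m B_N = ∂B_m/∂t_N, of order at most m - 1, so B_N is a polynomial in P up to a remainder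
  -- Y of order at most 0.
  obtain ⟨a, ha⟩ := exists_expansion hB hP N 1 (N + 1) (X := B N)
    (by
      intro c j hj m hm
      rw [covDt_smul, covDt]
      refine (((hPj j).1.smul _).mono (by omega)).add (OrdLE.smul _ ?_)
      refine (((hPj j).1.matDt m).mono (by omega)).sub ?_
      rcases j with _ | k
      · rw [pow_zero, Ring.lie_def, mul_one, one_mul, sub_self]
        exact OrdLE.zero _
      · exact (hlie m (PNat.coe_le_coe _ _ |>.mp hm.le) k).mono (by push_cast; omega))
    ((hB N).isMonic.1.mono (by push_cast; omega))
    (fun m hm => by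
      rw [covDt_eq_matDt hZS]
      exact ((hB m).isMonic.ordLE_matDt N).mono (by push_cast; omega))
  have haN : a N = 1 := eq_one_of_expansion hP N.pos (hB N).isMonic ha
  set Y := B N - ∑ j ∈ Finset.Ico 1 ((N : ℕ) + 1), a j • P ^ j with hY
  rw [show ((1 : ℕ) : ℤ) - 1 = 0 by norm_num] at ha
  obtain ⟨x, hx⟩ := exists_coboundary (N := N)
    (fun c hc => by
      have h1 : (N : ℚ)⁻¹ • ((N : TimeSeries A) * c) = c := by
        rw [← nsmul_eq_mul, ← Nat.cast_smul_eq_nsmul ℚ, smul_smul,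
          inv_mul_cancel₀ (by exact_mod_cast N.ne_zero), one_smul]
      rw [← h1, hc, smul_zero])
    -- The default at m = 0 plays no role, since only m ≥ N matters.
    (fun m s => if h : 0 < m then ⁅B ⟨m, h⟩, P⁆.coeff (m - n) s else 0)
    (fun s => Y.coeff 0 s)
    (by
      intro l m hl hm s
      have hl0 : 0 < l := by omega
      have hm0 : 0 < m := by omega
      simp only [dif_pos hl0, dif_pos hm0]
      set l' : ℕ+ := ⟨l, hl0⟩
      set m' : ℕ+ := ⟨m, hm0⟩
      have key : ∀ u v : ℕ+, N ≤ v → ∀ s, ⁅B u, ⁅B v, P⁆⁆.coeff (u + (v - n)) s =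
          ⁅B v, P⁆.coeff (v - n) (s + u) - ⁅B v, P⁆.coeff (v - n) s := by
        intro u v hv s
        rw [coeff_lie_top (hB u).isMonic.1 (hBP' v hv), (hB u).isMonic.2, (hB u).isMonic.2]
        ring
      have h1 := key l' m' hm s
      have h2 := key m' l' hl s
      have h3 : ⁅B l', ⁅B m', P⁆⁆ - ⁅B m', ⁅B l', P⁆⁆ = ⁅⁅B l', B m'⁆, P⁆ := by
        simp only [Ring.lie_def]; noncomm_ring
      -- The order of [[B_l, B_m], P] is at most max(l, m), which is below l + m - n because l, m >
      -- n.
      have h4 := (ordLE_lie_of_zakharovShabat hB hZS l' m').lie hP.1 (l + (m - n)) s (by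
        change max ((l : ℕ) : ℤ) (m : ℕ) - 1 + 1 < _
        omega)
      rw [← h3, coeff_sub] at h4
      change _ = ⁅B m', P⁆.coeff (m - n) (s + l) - ⁅B m', P⁆.coeff (m - n) s at h1
      change ⁅B m', ⁅B l', P⁆⁆.coeff (m + (l - n)) s =
        ⁅B l', P⁆.coeff (l - n) (s + m) - ⁅B l', P⁆.coeff (l - n) s at h2
      rw [← h1, ← h2, ← sub_eq_zero, ← h4, show (m : ℤ) + (l - n) = l + (m - n) by ring]
      rfl)
    (by
      intro m hm s
      have hm0 : 0 < m := by omega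
      simp only [dif_pos hm0]
      set m' : ℕ+ := ⟨m, hm0⟩
      have hBY : ⁅B m', Y⁆.coeff (m + 0) s = Y.coeff 0 (s + m) - Y.coeff 0 s := by
        have := coeff_lie_top (hB m').isMonic.1 ha s
        rw [(hB m').isMonic.2, (hB m').isMonic.2, one_mul, mul_one] at this
        exact this
      have hBY' : ⁅B m', Y⁆ =
          ⁅B m', B N⁆ - ∑ j ∈ Finset.Ico 1 ((N : ℕ) + 1), a j • ⁅B m', P ^ j⁆ := by
        rw [hY, lie_sub']
        congr 1
        rw [Ring.lie_def, Finset.mul_sum, Finset.sum_mul, ← Finset.sum_sub_distrib]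
        refine Finset.sum_congr rfl fun j _ => ?_
        rw [← lie_smul', Ring.lie_def]
      rw [← hBY, hBY', coeff_sub, (ordLE_lie_of_zakharovShabat hB hZS m' N) _ _ (by
        change max ((m : ℕ) : ℤ) (N : ℕ) - 1 < _
        omega), Finset.sum_Ico_succ_top N.pos, haN, one_smul, coeff_add, coeff_sum]
      -- At order m of [B_m, Y] only the term of P^N survives: [B_m, B_N] and the lower powers of P
      -- have smaller order.
      have h6 : ∑ j ∈ Finset.Ico 1 (N : ℕ), (a j • ⁅B m', P ^ j⁆).coeff (m + 0) s = 0 :=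
        Finset.sum_eq_zero fun j hj => by
          rw [Finset.mem_Ico] at hj
          obtain ⟨k, rfl⟩ := Nat.exists_eq_add_of_le' hj.1
          rw [coeff_smul, hlie m' hm k _ _ (by change _ + (((m : ℕ) : ℤ) - n) < _; omega),
            mul_zero]
      have h5 := (lie_pow_succ hP (hBP' m' hm) n).2 s
      change ⁅B m', P ^ (n + 1)⁆.coeff (n + (m - n)) s = _ at h5
      rw [show (n : ℤ) + (m - n) = m + 0 by ring] at h5
      erw [h6]
      change _ + (0 - (0 + ⁅B m', P ^ (n + 1)⁆.coeff (m + 0) s)) = 0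
      rw [h5, zero_add, zero_sub]
      exact add_neg_cancel _)
  refine ⟨P + single x (-n), hP.add (OrdLE.single x (-n)) (by omega), fun m => ?_, ?_⟩
  · have hsing : ⁅B m, single x (-n)⁆.OrdLE (m - n) := (hB m).isMonic.1.lie (OrdLE.single x (-n))
    rw [lie_add']
    by_cases hm : (N : ℕ) ≤ m
    · refine OrdLE.mono (((hBP' m hm).add hsing).pred fun s => ?_) (by omega)
      have h1 := hx m hm s
      rw [dif_pos m.pos] at h1
      have h2 := coeff_lie_top (hB m).isMonic.1 (OrdLE.single x (-n)) s
      rw [(hB m).isMonic.2, (hB m).isMonic.2, coeff_single, if_pos rfl, coeff_single, if_pos rfl,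
        one_mul, mul_one] at h2
      rw [coeff_add, ← h1, ← h2]
      rfl
    · exact ((hBP m).mono (by omega)).add (hsing.mono (by omega))
  · rw [add_sub_cancel_left]
    exact OrdLE.single x (-n)

/-- There is a matrix `P = Λ + ⋯` for which all commutators `[B_m, P]` have order at most `0`. -/
theorem exists_approximateCommutant [Algebra ℚ A] (hB : ∀ n : ℕ+, (B n).IsMonicUpper n)
    (hZS : ∀ m n : ℕ+, matDt n (B m) - matDt m (B n) + ⁅B m, B n⁆ = 0) :
    ∃ P : BandMat (TimeSeries A), P.IsMonic 1 ∧ ∀ m : ℕ+, ⁅B m, P⁆.OrdLE 0 := by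
  let T : ℕ → Type _ := fun n => {P : BandMat (TimeSeries A) // P.IsMonic 1 ∧
    ∀ m : ℕ+, ⁅B m, P⁆.OrdLE (max 0 (m - n))}
  have step : ∀ n (P : T n), ∃ P' : T (n + 1), (P'.1 - P.1).OrdLE (-n) := fun n P => by
    obtain ⟨P', h1, h2, h3⟩ := exists_step_approximateCommutant hB hZS n P.2.1 P.2.2
    exact ⟨⟨P', h1, h2⟩, h3⟩
  choose f hf using step
  let P₀ : T 0 := ⟨single (fun _ => 1) 1, IsMonic.single 1, fun m =>
    (((hB m).isMonic.ordLE_lie (IsMonic.single 1))).mono (by omega)⟩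
  let Z : ∀ n, T n := fun n => Nat.rec P₀ (fun n P => f n P) n
  have hZ : ∀ n : ℕ, ((Z (n + 1)).1 - (Z n).1).OrdLE (-n) := fun n => hf n (Z n)
  obtain ⟨P, hP⟩ := exists_limit (fun n => (Z n).1) hZ
  refine ⟨P, ?_, fun m => ?_⟩
  · have := (Z 0).2.1.add (hP 0) (by norm_num)
    rwa [add_sub_cancel] at this
  · have h1 := (hB m).isMonic.1.lie (hP m)
    rw [lie_sub'] at h1
    have h2 := ((Z m).2.2 m).add (h1.mono (q := max 0 ((m : ℤ) - (m : ℕ))) (by omega))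
    rw [add_sub_cancel] at h2
    exact h2.mono (by omega)

end ApproximateCommutant

/-! ### Closed families of power series. -/

section Poincare

variable {A : Type*} [CommRing A]

/-- The formal Poincaré lemma: a closed family of power series is a gradient. -/
theorem exists_dt_eq [Algebra ℚ A] (a : ℕ+ → TimeSeries A)
    (ha : ∀ m n, dt m (a n) = dt n (a m)) :
    ∃ f : TimeSeries A, MvPowerSeries.coeff 0 f = 0 ∧ ∀ n, dt n f = a n := by
  classical
  -- The coefficient of t^d in the potential can be found by integrating in any variable that
  -- divides t^d; closedness says that all of them give the same value.
  have key : ∀ (d : ℕ+ →₀ ℕ) (m n : ℕ+), d m ≠ 0 → d n ≠ 0 →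
      MvPowerSeries.coeff (d - Finsupp.single n 1) (a n) * (d m : A) =
        MvPowerSeries.coeff (d - Finsupp.single m 1) (a m) * (d n : A) := by
    intro d m n hm hn
    by_cases hmn : m = n
    · rw [hmn]
    · have h := congrArg
        (MvPowerSeries.coeff (d - Finsupp.single n 1 - Finsupp.single m 1)) (ha m n)
      rw [coeff_dt, coeff_dt] at h
      have e1 : d - Finsupp.single n 1 - Finsupp.single m 1 + Finsupp.single m 1 =
          d - Finsupp.single n 1 := by
        ext i
        simp only [Finsupp.coe_add, Finsupp.coe_tsub, Pi.add_apply, Pi.sub_apply,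
          Finsupp.single_apply]
        split_ifs <;> subst_vars <;> first | omega | exact absurd rfl hmn
      have e2 : d - Finsupp.single n 1 - Finsupp.single m 1 + Finsupp.single n 1 =
          d - Finsupp.single m 1 := by
        ext i
        simp only [Finsupp.coe_add, Finsupp.coe_tsub, Pi.add_apply, Pi.sub_apply,
          Finsupp.single_apply]
        split_ifs <;> subst_vars <;> first | omega | exact absurd rfl hmn
      have e3 : (d - Finsupp.single n 1 - Finsupp.single m 1 : ℕ+ →₀ ℕ) m + 1 = d m := by
        simp only [Finsupp.coe_tsub, Pi.sub_apply, Finsupp.single_apply, if_neg (Ne.symm hmn)]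
        simp
        omega
      have e4 : (d - Finsupp.single n 1 - Finsupp.single m 1 : ℕ+ →₀ ℕ) n + 1 = d n := by
        simp only [Finsupp.coe_tsub, Pi.sub_apply, Finsupp.single_apply, if_neg hmn]
        simp
        omega
      rw [e1, e2, ← Nat.cast_add_one, ← Nat.cast_add_one, e3, e4] at h
      exact h
  have hex : ∀ d : ℕ+ →₀ ℕ, ∃ m : ℕ+, d ≠ 0 → d m ≠ 0 := fun d => by
    by_cases h : d = 0
    · exact ⟨1, fun h' => absurd h h'⟩
    · obtain ⟨m, hm⟩ := Finsupp.ne_iff.mp h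
      exact ⟨m, fun _ => hm⟩
  choose μ hμ using hex
  let f : TimeSeries A := fun d => if d = 0 then 0 else
    ((d (μ d) : ℚ)⁻¹) • MvPowerSeries.coeff (d - Finsupp.single (μ d) 1) (a (μ d))
  have hf : ∀ d, MvPowerSeries.coeff d f = if d = 0 then 0 else
    ((d (μ d) : ℚ)⁻¹) • MvPowerSeries.coeff (d - Finsupp.single (μ d) 1) (a (μ d)) := fun _ => rfl
  refine ⟨f, by rw [hf, if_pos rfl], fun n => ?_⟩
  ext d
  have hd : d + Finsupp.single n 1 ≠ 0 := fun h => by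
    have := DFunLike.congr_fun h n
    simp at this
  have hn : (d + Finsupp.single n 1 : ℕ+ →₀ ℕ) n = d n + 1 := by simp
  have hm := hμ _ hd
  have hk := key _ _ n hm (by rw [hn]; omega)
  rw [add_tsub_cancel_right, hn] at hk
  rw [coeff_dt, hf, if_neg hd, smul_mul_assoc, ← Nat.cast_add_one, ← hk, mul_comm,
    ← nsmul_eq_mul, ← Nat.cast_smul_eq_nsmul ℚ, smul_smul,
    inv_mul_cancel₀ (by exact_mod_cast hm), one_smul]

end Poincare

/-! ### Existence of L. -/

section Existence

open BandMat

variable {A : Type*} [CommRing A] {B : ℕ+ → BandMat (TimeSeries A)}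

theorem BandMat.IsMonic.pow_covDt {X : BandMat (TimeSeries A)} {p : ℤ} (hX : X.IsMonic p)
    {m : ℕ+} (hD : (covDt B m X).OrdLE (p - 1)) (k : ℕ) :
    (covDt B m (X ^ k)).OrdLE (k * p - 1) := by
  induction k with
  | zero => rw [pow_zero, covDt_one]; exact OrdLE.zero _
  | succ k ih =>
    rw [pow_succ, covDt_mul, show ((k + 1 : ℕ) : ℤ) * p - 1 = k * p - 1 + p by push_cast; ring]
    refine (ih.mul hX.1).add ?_
    rw [show (k : ℤ) * p - 1 + p = k * p + (p - 1) by ring]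
    exact (hX.pow k).1.mul hD

/-- Powers of P and of its inverse provide a leading term of every order whose order each D_m
lowers. They are used to subtract leading terms without spoiling bounds on D_m. -/
theorem exists_monic_family {P : BandMat (TimeSeries A)} (hP : P.IsMonic 1)
    (hD : ∀ m, (covDt B m P).OrdLE 0) :
    ∃ E : ℤ → BandMat (TimeSeries A),
      ∀ k, (E k).IsMonic k ∧ ∀ m, (covDt B m (E k)).OrdLE (k - 1) := by
  obtain ⟨Q, hQ, hQP, hPQ⟩ := hP.exists_inverse
  have hDQ : ∀ m, (covDt B m Q).OrdLE (-1 - 1) := fun m => by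
    have h := covDt_mul (B := B) m Q P
    rw [hQP, covDt_one] at h
    have h2 : covDt B m Q = -(Q * covDt B m P * Q) := by
      calc covDt B m Q = covDt B m Q * P * Q := by rw [mul_assoc, hPQ, mul_one]
        _ = -(Q * covDt B m P * Q) := by
          rw [eq_neg_of_add_eq_zero_left h.symm]
          noncomm_ring
    rw [h2]
    exact ((hQ.1.mul (hD m)).mul hQ.1).neg.mono (by norm_num)
  refine ⟨fun k => if 0 ≤ k then P ^ k.toNat else Q ^ (-k).toNat, fun k => ?_⟩
  by_cases hk : 0 ≤ k
  · simp only [if_pos hk]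
    have e : (k.toNat : ℤ) * 1 = k := by omega
    rw [← e]
    exact ⟨by simpa only [e] using hP.pow k.toNat, fun m => by
      simpa only [e] using hP.pow_covDt ((hD m).mono (by norm_num)) k.toNat⟩
  · simp only [if_neg hk]
    have e : ((-k).toNat : ℤ) * (-1) = k := by omega
    exact ⟨by simpa only [e] using hQ.pow (-k).toNat, fun m => by
      simpa only [e] using hQ.pow_covDt (hDQ m) (-k).toNat⟩

/-- The orders of all `D_m X` are bounded by a common constant. -/
def BoundedCovDt (B : ℕ+ → BandMat (TimeSeries A)) (X : BandMat (TimeSeries A)) : Prop :=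
  ∃ C : ℤ, ∀ m, (covDt B m X).OrdLE C

theorem BoundedCovDt.sub {X Y : BandMat (TimeSeries A)} (hX : BoundedCovDt B X)
    (hY : BoundedCovDt B Y) : BoundedCovDt B (X - Y) := by
  obtain ⟨C, hC⟩ := hX
  obtain ⟨D, hD⟩ := hY
  refine ⟨max C D, fun m => ?_⟩
  rw [covDt_sub]
  exact ((hC m).mono (le_max_left _ _)).sub ((hD m).mono (le_max_right _ _))

theorem BoundedCovDt.smul_of_isMonic {X : BandMat (TimeSeries A)} {p : ℤ} (hX : X.IsMonic p)
    (hD : ∀ m, (covDt B m X).OrdLE (p - 1)) (c : TimeSeries A) : BoundedCovDt B (c • X) :=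
  ⟨p, fun m => by
    rw [covDt_smul]
    exact (hX.1.smul _).add (((hD m).smul _).mono (by omega))⟩

theorem BoundedCovDt.covDt (hB : ∀ n : ℕ+, (B n).IsMonicUpper n)
    (hZS : ∀ m n : ℕ+, matDt n (B m) - matDt m (B n) + ⁅B m, B n⁆ = 0)
    {X : BandMat (TimeSeries A)} (hX : BoundedCovDt B X) (l : ℕ+) :
    BoundedCovDt B (covDt B l X) := by
  obtain ⟨C, hC⟩ := hX
  refine ⟨l + C, fun m => ?_⟩
  rw [covDt_comm hZS]
  exact ordLE_covDt hB l (hC m)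

theorem BoundedCovDt.coeff_top (hB : ∀ n : ℕ+, (B n).IsMonicUpper n)
    {X : BandMat (TimeSeries A)} (hX : BoundedCovDt B X) {p : ℤ} (hp : X.OrdLE p) (s : ℤ) :
    X.coeff p s = X.coeff p 0 := by
  obtain ⟨C, hC⟩ := hX
  exact coeff_eq_coeff_zero_of_covDt hB hp (C - p + 1).toNat
    (fun m hm => (hC m).mono (by omega)) s

/-- If the orders of all `D_m X` are bounded, then `D_l` does not raise the order of `X` and acts
on its leading coefficient, which is constant along the diagonal, as `∂/∂t_l`. -/
theorem BoundedCovDt.covDt_top (hB : ∀ n : ℕ+, (B n).IsMonicUpper n)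
    {E : ℤ → BandMat (TimeSeries A)}
    (hE : ∀ k, (E k).IsMonic k ∧ ∀ m, (_root_.covDt B m (E k)).OrdLE (k - 1))
    {X : BandMat (TimeSeries A)} (hX : BoundedCovDt B X) {p : ℤ} (hp : X.OrdLE p) (l : ℕ+) :
    (_root_.covDt B l X).OrdLE p ∧
      ∀ s, (_root_.covDt B l X).coeff p s = dt l (X.coeff p 0) := by
  have split : ∀ {X : BandMat (TimeSeries A)} {p : ℤ}, BoundedCovDt B X → X.OrdLE p →
      ∃ Y, BoundedCovDt B Y ∧ Y.OrdLE (p - 1) ∧ X = X.coeff p 0 • E p + Y := by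
    intro X p hX hp
    refine ⟨X - X.coeff p 0 • E p, hX.sub (.smul_of_isMonic (hE p).1 (hE p).2 _),
      (hp.sub ((hE p).1.1.smul _)).pred fun s => ?_, by abel⟩
    rw [coeff_sub, coeff_smul, (hE p).1.2, hX.coeff_top hB hp, mul_one, sub_self]
  -- A priori D_l raises the order by l. Each split lowers this excess by one, so k = l leaves none.
  have bound : ∀ (k : ℕ) {X : BandMat (TimeSeries A)} {p : ℤ}, BoundedCovDt B X → X.OrdLE p →
      (_root_.covDt B l X).OrdLE (p + max 0 (l - k)) := by
    intro k
    induction k with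
    | zero => exact fun _ hp => (ordLE_covDt hB l hp).mono (by omega)
    | succ k ih =>
      intro X p hX hp
      obtain ⟨Y, hY, hYp, hXY⟩ := split hX hp
      rw [hXY, covDt_add, covDt_smul]
      exact ((((hE p).1.1.smul _).mono (by omega)).add
        ((((hE p).2 l).smul _).mono (by omega))).add ((ih hY hYp).mono (by push_cast; omega))
  have bound' : ∀ {X : BandMat (TimeSeries A)} {p : ℤ}, BoundedCovDt B X → X.OrdLE p →
      (_root_.covDt B l X).OrdLE p := fun hX hp => (bound l hX hp).mono (by omega)
  refine ⟨bound' hX hp, fun s => ?_⟩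
  obtain ⟨Y, hY, hYp, hXY⟩ := split hX hp
  have h : _root_.covDt B l X = dt l (X.coeff p 0) • E p +
      X.coeff p 0 • _root_.covDt B l (E p) + _root_.covDt B l Y := by
    rw [← covDt_smul, ← covDt_add, ← hXY]
  rw [h, coeff_add, coeff_add, coeff_smul, coeff_smul, (hE p).1.2, (hE p).2 l _ _ (by omega),
    bound' hY hYp _ _ (by omega)]
  ring

theorem exists_lax [Algebra ℚ A] (hB : ∀ n : ℕ+, (B n).IsMonicUpper n)
    (hZS : ∀ m n : ℕ+, matDt n (B m) - matDt m (B n) + ⁅B m, B n⁆ = 0) :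
    ∃ L : BandMat (TimeSeries A), L.IsLaxForm ∧ ∀ n : ℕ+, matDt n L = ⁅B n, L⁆ := by
  obtain ⟨P, hP, hBP⟩ := exists_approximateCommutant hB hZS
  have hDP : ∀ m, (covDt B m P).OrdLE 0 := fun m => (hP.ordLE_matDt m).sub (hBP m)
  obtain ⟨E, hE⟩ := exists_monic_family hP hDP
  let T : ℕ → Type _ := fun n => {L : BandMat (TimeSeries A) // L.IsMonic 1 ∧
    ∀ m : ℕ+, (covDt B m L).OrdLE (-n)}
  have step : ∀ n (L : T n), ∃ L' : T (n + 1), (L'.1 - L.1).OrdLE (-n) := by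
    rintro n ⟨L, hL, hDL⟩
    have hLb : BoundedCovDt B L := ⟨-n, hDL⟩
    -- The errors D_m L are again bounded, so D_l D_m L has coefficient ∂g_l-wise derivative of that
    -- of D_m L at order -n; commutation of the D's is closedness.
    obtain ⟨g, -, hg⟩ := exists_dt_eq (fun m => (covDt B m L).coeff (-n) 0) fun l m => by
      rw [← ((hLb.covDt hB hZS m).covDt_top hB hE (hDL m) l).2 0,
        ← ((hLb.covDt hB hZS l).covDt_top hB hE (hDL l) m).2 0, covDt_comm hZS]
    have hgE : (g • E (-n)).OrdLE (-n) := (hE _).1.1.smul _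
    refine ⟨⟨L - g • E (-n), ?_, fun m => ?_⟩, ?_⟩
    · rw [sub_eq_add_neg]
      exact hL.add hgE.neg (by omega)
    · rw [covDt_sub, covDt_smul, hg m]
      have h1 : ((-(n + 1 : ℕ) : ℤ)) = -n - 1 := by push_cast; ring
      rw [h1]
      refine ((hDL m).sub (((hE _).1.1.smul _).add ((((hE _).2 m).smul _).mono
        (by omega)))).pred fun s => ?_
      rw [coeff_sub, coeff_add, coeff_smul, coeff_smul, (hE _).1.2, (hE _).2 m _ _ (by omega),
        (hLb.covDt hB hZS m).coeff_top hB (hDL m)]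
      ring
    · change (L - g • E (-n) - L).OrdLE (-n)
      rw [sub_sub_cancel_left]
      exact hgE.neg
  choose f hf using step
  let L₀ : T 0 := ⟨P, hP, hDP⟩
  let Z : ∀ n, T n := fun n => Nat.rec L₀ (fun n L => f n L) n
  have hZ : ∀ n : ℕ, ((Z (n + 1)).1 - (Z n).1).OrdLE (-n) := fun n => hf n (Z n)
  obtain ⟨L, hL⟩ := exists_limit (fun n => (Z n).1) hZ
  refine ⟨L, ?_, fun m => ?_⟩
  · have := (Z 0).2.1.add (hL 0) (by norm_num)
    rwa [add_sub_cancel] at this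
  · rw [← sub_eq_zero]
    change covDt B m L = 0
    refine eq_zero_of_ordLE fun n => ⟨-n, le_rfl, ?_⟩
    -- The index n + m makes up for D_m raising the order by m.
    have h1 := ordLE_covDt hB m (hL (n + m))
    rw [covDt_sub] at h1
    have h2 := (((Z (n + m)).2.2 m).mono (q := -n) (by push_cast; omega)).add
      (h1.mono (by push_cast; omega))
    rwa [add_sub_cancel] at h2

end Existence

/-! ### Triangular substitutions: inversion and chain rule. -/

section TriangularSubstitution

open MvPowerSeries

variable {A : Type*} [CommRing A]

/-- The weight of a monomial in the times, `t_n` having weight `n`. -/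
noncomputable def timeWeight : (ℕ+ →₀ ℕ) →+ ℕ := Finsupp.weight fun n : ℕ+ => (n : ℕ)

theorem timeWeight_single (n : ℕ+) : timeWeight (Finsupp.single n 1) = n := by
  rw [timeWeight, Finsupp.weight_single, one_smul]

theorem le_timeWeight {d : ℕ+ →₀ ℕ} {i : ℕ+} (hi : i ∈ d.support) : (i : ℕ) ≤ timeWeight d :=
  Finsupp.le_weight_of_ne_zero' _ (Finsupp.mem_support_iff.mp hi)

/-- All monomials of `f` have weight at least `w`. -/
def WeightGE (w : ℕ) (f : TimeSeries A) : Prop := ∀ d, timeWeight d < w → coeff d f = 0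

theorem WeightGE.mul {v w : ℕ} {f g : TimeSeries A} (hf : WeightGE v f) (hg : WeightGE w g) :
    WeightGE (v + w) (f * g) := fun d hd => by
  classical
  rw [coeff_mul]
  refine Finset.sum_eq_zero fun p hp => ?_
  rw [Finset.HasAntidiagonal.mem_antidiagonal] at hp
  rw [← hp, map_add] at hd
  by_cases h : timeWeight p.1 < v
  · rw [hf _ h, zero_mul]
  · rw [hg _ (by omega), mul_zero]

theorem WeightGE.add {w : ℕ} {f g : TimeSeries A} (hf : WeightGE w f) (hg : WeightGE w g) :
    WeightGE w (f + g) := fun d hd => by rw [map_add, hf d hd, hg d hd, add_zero]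

theorem WeightGE.mono {v w : ℕ} {f : TimeSeries A} (hf : WeightGE w f) (h : v ≤ w) :
    WeightGE v f := fun d hd => hf d (hd.trans_le h)

theorem WeightGE.monomial (d : ℕ+ →₀ ℕ) (r : A) :
    WeightGE (timeWeight d) (MvPowerSeries.monomial d r) := fun e he => by
  classical
  rw [coeff_monomial, if_neg]
  rintro rfl
  exact lt_irrefl _ he

/-- `f` involves only the times `t_i` with `i > n`. -/
def OnlyAbove (n : ℕ+) (f : TimeSeries A) : Prop :=
  ∀ d, coeff d f ≠ 0 → ∀ i ∈ d.support, n < i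

theorem OnlyAbove.one (n : ℕ+) : OnlyAbove n (1 : TimeSeries A) := fun d hd i hi => by
  classical
  rw [coeff_one] at hd
  rw [(ite_ne_right_iff.mp hd).1] at hi
  simp at hi

theorem OnlyAbove.mul {n : ℕ+} {f g : TimeSeries A} (hf : OnlyAbove n f) (hg : OnlyAbove n g) :
    OnlyAbove n (f * g) := fun d hd i hi => by
  classical
  rw [coeff_mul] at hd
  obtain ⟨p, hp, hne⟩ := Finset.exists_ne_zero_of_sum_ne_zero hd
  rw [Finset.HasAntidiagonal.mem_antidiagonal] at hp
  rw [← hp] at hi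
  rcases Finset.mem_union.mp (Finsupp.support_add hi) with h | h
  · exact hf _ (left_ne_zero_of_mul hne) i h
  · exact hg _ (right_ne_zero_of_mul hne) i h

theorem OnlyAbove.pow {n : ℕ+} {f : TimeSeries A} (hf : OnlyAbove n f) (k : ℕ) :
    OnlyAbove n (f ^ k) := by
  induction k with
  | zero => rw [pow_zero]; exact OnlyAbove.one n
  | succ k ih => rw [pow_succ]; exact ih.mul hf

theorem OnlyAbove.finset_prod {ι : Type*} {n : ℕ+} {t : Finset ι} {f : ι → TimeSeries A}
    (hf : ∀ i ∈ t, OnlyAbove n (f i)) : OnlyAbove n (∏ i ∈ t, f i) :=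
  Finset.prod_induction _ (OnlyAbove n) (fun _ _ h h' => h.mul h') (OnlyAbove.one n) hf

namespace IsTriangular

variable {τ : ℕ+ → TimeSeries A}

theorem coeff_eq_zero (h : IsTriangular τ) {n i : ℕ+} {d : ℕ+ →₀ ℕ} (hi : i ∈ d.support)
    (hin : i < n) : coeff d (τ n) = 0 := by
  classical
  have hX : coeff d (X n : TimeSeries A) = 0 := by
    rw [coeff_X, if_neg]
    rintro rfl
    rw [Finsupp.mem_support_iff, Finsupp.single_apply] at hi
    exact hi (if_neg hin.ne')
  by_contra hne
  exact absurd ((h n d (by rwa [map_sub, hX, sub_zero])).2 i hi) (not_lt.mpr hin.le)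

theorem dt_eq_zero (h : IsTriangular τ) {n i : ℕ+} (hin : i < n) : dt i (τ n) = 0 := by
  ext d
  rw [coeff_dt, h.coeff_eq_zero (i := i) (by simp) hin, zero_mul, map_zero]

theorem dt_self (h : IsTriangular τ) (n : ℕ+) : dt n (τ n) = 1 := by
  have h1 : dt n (τ n - X n) = 0 := by
    ext d
    rw [coeff_dt]
    by_cases hne : coeff (d + Finsupp.single n 1) (τ n - X n) = 0
    · rw [hne, zero_mul, map_zero]
    · exact absurd ((h n _ hne).2 n (by simp)) (lt_irrefl n)
  have h2 : dt n (X n : TimeSeries A) = 1 := pderiv_X_self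
  rw [map_sub, h2, sub_eq_zero] at h1
  exact h1

theorem onlyAbove (h : IsTriangular τ) {n i : ℕ+} (hni : n < i) : OnlyAbove n (τ i) :=
  fun d hd j hj => by
    by_contra hcon
    exact hd (h.coeff_eq_zero hj (lt_of_le_of_lt (not_lt.mp hcon) hni))

/-- Later times weigh more, so in this grading a triangular substitution is the identity plus a part
that raises the weight. -/
theorem weightGE_sub (h : IsTriangular τ) (n : ℕ+) : WeightGE (n + 1) (τ n - X n) :=
  fun d hd => by
    by_contra hne
    obtain ⟨hd0, hlt⟩ := h n d hne
    obtain ⟨i, hi⟩ := Finsupp.support_nonempty_iff.mpr hd0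
    have h1 := le_timeWeight hi
    have h2 : (n : ℕ) < i := hlt i hi
    omega

theorem weightGE_prod_sub (h : IsTriangular τ) (d : ℕ+ →₀ ℕ) :
    WeightGE (timeWeight d + 1) ((d.prod fun n k => τ n ^ k) - monomial d 1) := by
  classical
  have hadd : ∀ d e : ℕ+ →₀ ℕ,
      WeightGE (timeWeight d + 1) ((d.prod fun n k => τ n ^ k) - monomial d 1) →
      WeightGE (timeWeight e + 1) ((e.prod fun n k => τ n ^ k) - monomial e 1) →
      WeightGE (timeWeight (d + e) + 1)
        (((d + e).prod fun n k => τ n ^ k) - monomial (d + e) 1) := by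
    intro d e hd he
    rw [Finsupp.prod_add_index' (fun _ => pow_zero _) (fun _ _ _ => pow_add _ _ _),
      ← one_mul (1 : A), ← monomial_mul_monomial, map_add]
    set p := d.prod fun n k => τ n ^ k
    set q := e.prod fun n k => τ n ^ k
    have hq : WeightGE (timeWeight e) q := by
      have := (he.mono (Nat.le_succ _)).add (WeightGE.monomial e (1 : A))
      rwa [sub_add_cancel] at this
    have e1 : p * q - monomial d (1 : A) * monomial e 1 =
        (p - monomial d 1) * q + monomial d 1 * (q - monomial e 1) := by ring
    rw [e1]
    exact ((hd.mul hq).mono (by omega)).add (((WeightGE.monomial d (1 : A)).mul he).mono (by omega))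
  have h0 : WeightGE (timeWeight 0 + 1)
      (((0 : ℕ+ →₀ ℕ).prod fun n k => τ n ^ k) - monomial 0 (1 : A)) := by
    rw [Finsupp.prod_zero_index, monomial_zero_one, sub_self]
    exact fun _ _ => map_zero _
  induction d using Finsupp.induction_linear with
  | zero => exact h0
  | add d e hd he => exact hadd d e hd he
  | single n k =>
    induction k with
    | zero => rw [Finsupp.single_zero]; exact h0
    | succ k ih =>
      rw [Finsupp.single_add]
      refine hadd _ _ ih ?_
      rw [timeWeight_single, Finsupp.prod_single_index (h := fun n k => τ n ^ k) (pow_zero _),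
        pow_one]
      exact h.weightGE_sub n

theorem coeff_prod (h : IsTriangular τ) {d e : ℕ+ →₀ ℕ} (hle : timeWeight e ≤ timeWeight d) :
    coeff e (d.prod fun n k => τ n ^ k) = coeff e (monomial d (1 : A)) := by
  have := h.weightGE_prod_sub d e (by omega)
  rwa [map_sub, sub_eq_zero] at this

/-- The product τ^d is t^d plus terms of greater weight, so apart from d = e only monomials lighter
than e could contribute. -/
theorem coeff_subst_eq (h : IsTriangular τ) {f : TimeSeries A} {e : ℕ+ →₀ ℕ}
    (hf : ∀ d, timeWeight d < timeWeight e →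
      coeff d f * coeff e (d.prod fun n k => τ n ^ k) = 0) :
    coeff e (subst τ f) = coeff e f := by
  classical
  rw [coeff_subst h.hasSubst, finsum_eq_single _ e]
  · rw [h.coeff_prod le_rfl, coeff_monomial_same, smul_eq_mul, mul_one]
  · intro d hd
    rw [smul_eq_mul]
    by_cases hlt : timeWeight d < timeWeight e
    · exact hf d hlt
    · rw [h.coeff_prod (not_lt.mp hlt), coeff_monomial_ne (Ne.symm hd), mul_zero]

theorem coeff_subst_of_weightGE (h : IsTriangular τ) {f : TimeSeries A} {w : ℕ}
    (hf : WeightGE w f) {e : ℕ+ →₀ ℕ} (he : timeWeight e ≤ w) :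
    coeff e (subst τ f) = coeff e f :=
  h.coeff_subst_eq fun d hd => by rw [hf d (by omega), zero_mul]

theorem subst_injective (h : IsTriangular τ) :
    Function.Injective (subst τ : TimeSeries A → TimeSeries A) := by
  intro f g hfg
  rw [← sub_eq_zero]
  have h0 : subst τ (f - g) = 0 := by rw [subst_sub h.hasSubst, hfg, sub_self]
  have key : ∀ w, WeightGE w (f - g) := by
    intro w
    induction w with
    | zero => exact fun d hd => absurd hd (Nat.not_lt_zero _)
    | succ w ih =>
      intro d hd
      rw [← h.coeff_subst_of_weightGE ih (Nat.lt_succ_iff.mp hd), h0, map_zero]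
  ext d
  exact key _ d (Nat.lt_succ_self _)

/-- Neumann series again: the map x ↦ x - `subst τ x` raises the weight, and the sum of its iterates
on g is a preimage of g. -/
theorem subst_surjective (h : IsTriangular τ) :
    Function.Surjective (subst τ : TimeSeries A → TimeSeries A) := by
  intro g
  let r : ℕ → TimeSeries A := fun k => Nat.rec g (fun _ x => x - subst τ x) k
  have hr : ∀ k, r (k + 1) = r k - subst τ (r k) := fun _ => rfl
  have hw : ∀ k, WeightGE k (r k) := by
    intro k
    induction k with
    | zero => exact fun d hd => absurd hd (Nat.not_lt_zero _)
    | succ k ih =>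
      intro d hd
      rw [hr, map_sub, h.coeff_subst_of_weightGE ih (Nat.lt_succ_iff.mp hd), sub_self]
  have hsum : ∀ k, subst τ (∑ i ∈ Finset.range k, r i) = g - r k := by
    intro k
    rw [← substAlgHom_apply h.hasSubst, map_sum]
    simp only [substAlgHom_apply]
    rw [← Finset.sum_congr rfl fun i _ => show r i - r (i + 1) = subst τ (r i) by
      rw [hr, sub_sub_cancel], Finset.sum_range_sub']
    rfl
  let f : TimeSeries A := fun d => coeff d (∑ i ∈ Finset.range (timeWeight d + 1), r i)
  have hf : ∀ k, WeightGE k (f - ∑ i ∈ Finset.range k, r i) := by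
    intro k d hd
    rw [map_sub, sub_eq_zero]
    change coeff d (∑ i ∈ Finset.range (timeWeight d + 1), r i) = _
    rw [map_sum, map_sum]
    refine Finset.sum_subset (Finset.range_subset_range.mpr hd) fun i _ hi => hw i d ?_
    rw [Finset.mem_range] at hi
    omega
  refine ⟨f, ?_⟩
  ext d
  have h1 := h.coeff_subst_of_weightGE (hf (timeWeight d + 1)) (Nat.le_succ (timeWeight d))
  rw [hf _ d (Nat.lt_succ_self _), subst_sub h.hasSubst, hsum, map_sub, map_sub,
    hw _ d (Nat.lt_succ_self _), sub_zero, sub_eq_zero] at h1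
  exact h1

/-- Substituting τ in σ_n - t_n gives -(τ_n - t_n), which has only admissible monomials. By
induction on the weight, the lighter monomials of σ_n - t_n involve only t_i with i > n and turn
into series in such variables, so they cannot produce an inadmissible one. -/
theorem inverse (h : IsTriangular τ) {σ : ℕ+ → TimeSeries A} (hσ : ∀ n, subst τ (σ n) = X n) :
    IsTriangular σ := by
  intro n
  have hsub : subst τ (σ n - X n) = -(τ n - X n) := by
    rw [subst_sub h.hasSubst, hσ, subst_X h.hasSubst, neg_sub]
  have key : ∀ w : ℕ, ∀ d : ℕ+ →₀ ℕ, timeWeight d = w → coeff d (σ n - X n) ≠ 0 →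
      d ≠ 0 ∧ ∀ i ∈ d.support, n < i := by
    intro w
    induction w using Nat.strong_induction_on with
    | _ w ih =>
      rintro e rfl he
      by_contra hcon
      apply he
      rw [← h.coeff_subst_eq (f := σ n - X n) (e := e), hsub]
      · by_contra hne
        rw [map_neg, neg_eq_zero] at hne
        exact hcon (h n e hne)
      · intro d hd
        by_contra hne
        obtain ⟨-, hlt⟩ := ih _ hd d rfl (left_ne_zero_of_mul hne)
        refine hcon ⟨?_, ?_⟩
        · rintro rfl
          rw [map_zero] at hd
          exact Nat.not_lt_zero _ hd
        · exact OnlyAbove.finset_prod (fun i hi => (h.onlyAbove (hlt i hi)).pow _) e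
            (right_ne_zero_of_mul hne)
  exact fun d => key _ d rfl

/-- A triangular family of series is the first half of a triangular change of times. -/
theorem exists_timeChange (h : IsTriangular τ) : ∃ c : TimeChange A, c.new = τ := by
  choose σ hσ using fun n => h.subst_surjective (X n)
  have hσt := h.inverse hσ
  refine ⟨⟨τ, σ, h, hσt, fun n => h.subst_injective ?_, hσ⟩, rfl⟩
  rw [subst_comp_subst_apply hσt.hasSubst h.hasSubst, funext hσ, subst_X h.hasSubst, subst_self]
  rfl

open scoped MvPowerSeries.WithPiTopology in
/-- The chain rule for a triangular change of times. -/
theorem dt_subst (h : IsTriangular τ) (N : ℕ+) (f : TimeSeries A) :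
    dt N (subst τ f) = ∑ k ∈ Finset.Icc 1 N, dt N (τ k) * subst τ (dt k f) := by
  classical
  -- For discrete A both sides are continuous in f and polynomials are dense, so it is enough to
  -- treat polynomials.
  let _ : UniformSpace A := ⊥
  have hpoly : ∀ p : MvPolynomial ℕ+ A, dt N (subst τ (p : TimeSeries A)) =
      ∑ k ∈ Finset.Icc 1 N, dt N (τ k) * subst τ (dt k (p : TimeSeries A)) := by
    intro p
    induction p using MvPolynomial.induction_on with
    | C r =>
      have hC : ∀ n : ℕ+, dt n (C r : TimeSeries A) = 0 := fun n => pderiv_C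
      have h0 : subst τ (0 : TimeSeries A) = 0 := by
        rw [← substAlgHom_apply h.hasSubst, map_zero]
      simp only [MvPolynomial.coe_C, subst_C, hC, h0, mul_zero, Finset.sum_const_zero]
    | add p q hp hq =>
      simp only [MvPolynomial.coe_add, subst_add h.hasSubst, map_add, hp, hq, mul_add,
        Finset.sum_add_distrib]
    | mul_X p n hp =>
      have hX : ∑ k ∈ Finset.Icc 1 N, dt N (τ k) * subst τ (dt k (X n : TimeSeries A)) =
          dt N (τ n) := by
        have hXn : ∀ k, k ≠ n → dt k (X n : TimeSeries A) = 0 := fun k hk =>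
          pderiv_X_of_ne (Ne.symm hk)
        have hXs : dt n (X n : TimeSeries A) = 1 := pderiv_X_self
        rw [Finset.sum_eq_single n]
        · rw [hXs, ← substAlgHom_apply h.hasSubst, map_one, mul_one]
        · intro k _ hk
          rw [hXn k hk, ← substAlgHom_apply h.hasSubst, map_zero, mul_zero]
        -- The sum may stop at N because τ_n with n > N does not depend on t_N.
        · intro hn
          rw [h.dt_eq_zero (lt_of_not_ge fun hle => hn (Finset.mem_Icc.mpr ⟨one_le, hle⟩)),
            zero_mul]
      simp only [MvPolynomial.coe_mul, MvPolynomial.coe_X, subst_mul h.hasSubst, dt_mul,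
        subst_add h.hasSubst, mul_add, Finset.sum_add_distrib, subst_X h.hasSubst, hp]
      rw [← hX, Finset.mul_sum, Finset.mul_sum]
      congr 1 <;> exact Finset.sum_congr rfl fun k _ => by ring
  have hdt : ∀ n : ℕ+, Continuous (dt n : TimeSeries A → TimeSeries A) := fun n => by
    refine continuous_pi fun d => ?_
    have : (fun f : TimeSeries A => dt n f d) =
        fun f => coeff (d + Finsupp.single n 1) f * ((d n : A) + 1) :=
      funext fun f => coeff_dt n f d
    rw [this]
    exact (WithPiTopology.continuous_coeff A _).mul continuous_const
  have hsubst := continuous_subst (R := A) h.hasSubst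
  have hcont : Continuous fun f : TimeSeries A =>
      ∑ k ∈ Finset.Icc 1 N, dt N (τ k) * subst τ (dt k f) :=
    continuous_finsetSum _ fun k _ => continuous_const.mul (hsubst.comp (hdt k))
  refine congrFun (Continuous.ext_on (WithPiTopology.denseRange_toMvPowerSeries (R := A) (σ := ℕ+))
    ((hdt N).comp hsubst) hcont ?_) f
  rintro _ ⟨p, rfl⟩
  exact hpoly p

end IsTriangular

end TriangularSubstitution

/-! ### Band matrices under a change of times. -/

section ChangeOfTimes

open BandMat

variable {A : Type*} [CommRing A]

theorem BandMat.mapEntries_mul {R S : Type*} [CommRing R] [CommRing S] (φ : R →+ S)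
    (hφ : ∀ a b, φ (a * b) = φ a * φ b) (X Y : BandMat R) :
    (X * Y).mapEntries φ = X.mapEntries φ * Y.mapEntries φ := ext' fun i j => by
  rw [mul_entry]
  change φ ((X * Y).1 i j) = _
  rw [mul_entry, AddMonoidHom.map_finsum _ (mul_entry_support_finite X Y i j)]
  exact finsum_congr fun k => hφ _ _

theorem BandMat.mapEntries_pow {R S : Type*} [CommRing R] [CommRing S] (φ : R →+ S)
    (h1 : φ 1 = 1) (hφ : ∀ a b, φ (a * b) = φ a * φ b) (X : BandMat R) (k : ℕ) :
    (X ^ k).mapEntries φ = X.mapEntries φ ^ k := by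
  induction k with
  | zero =>
    rw [pow_zero, pow_zero]
    refine ext_coeff fun j s => ?_
    rw [coeff_mapEntries, coeff_one, coeff_one]
    split_ifs
    · exact h1
    · exact map_zero φ
  | succ k ih => rw [pow_succ, pow_succ, mapEntries_mul φ hφ, ih]

theorem BandMat.mapEntries_plus {R S : Type*} [CommRing R] [CommRing S] (φ : R →+ S)
    (X : BandMat R) : X.plus.mapEntries φ = (X.mapEntries φ).plus := ext_coeff fun j s => by
  rw [coeff_mapEntries, coeff_plus, coeff_plus, coeff_mapEntries, apply_ite φ, map_zero]

theorem BandMat.mapEntries_lie {R S : Type*} [CommRing R] [CommRing S] (φ : R →+ S)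
    (hφ : ∀ a b, φ (a * b) = φ a * φ b) (X Y : BandMat R) :
    ⁅X, Y⁆.mapEntries φ = ⁅X.mapEntries φ, Y.mapEntries φ⁆ := by
  rw [Ring.lie_def, Ring.lie_def, mapEntries_sub, mapEntries_mul φ hφ, mapEntries_mul φ hφ]

namespace TimeChange

theorem toNew_apply (c : TimeChange A) (f : TimeSeries A) :
    c.toNew f = MvPowerSeries.subst c.old f :=
  MvPowerSeries.substAlgHom_apply c.old_triangular.hasSubst f

theorem toOld_apply (c : TimeChange A) (f : TimeSeries A) :
    c.toOld f = MvPowerSeries.subst c.new f :=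
  MvPowerSeries.substAlgHom_apply c.new_triangular.hasSubst f

theorem toNew_toOld (c : TimeChange A) (f : TimeSeries A) : c.toNew (c.toOld f) = f := by
  rw [toNew_apply, toOld_apply, MvPowerSeries.subst_comp_subst_apply c.new_triangular.hasSubst
    c.old_triangular.hasSubst, funext c.new_old, MvPowerSeries.subst_self]
  rfl

theorem toOld_toNew (c : TimeChange A) (f : TimeSeries A) : c.toOld (c.toNew f) = f := by
  rw [toNew_apply, toOld_apply, MvPowerSeries.subst_comp_subst_apply c.old_triangular.hasSubst
    c.new_triangular.hasSubst, funext c.old_new, MvPowerSeries.subst_self]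
  rfl

theorem toNew_one (c : TimeChange A) : c.toNew 1 = 1 :=
  map_one (MvPowerSeries.substAlgHom (R := A) c.old_triangular.hasSubst)

theorem toNew_mul (c : TimeChange A) (f g : TimeSeries A) :
    c.toNew (f * g) = c.toNew f * c.toNew g :=
  map_mul (MvPowerSeries.substAlgHom (R := A) c.old_triangular.hasSubst) f g

theorem dt_eq_sum (c : TimeChange A) (n : ℕ+) (f : TimeSeries A) :
    dt n f = ∑ k ∈ Finset.Icc 1 n, dt n (c.new k) * c.dtNew k f := by
  conv_lhs => rw [← c.toOld_toNew f, toOld_apply, c.new_triangular.dt_subst]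
  exact Finset.sum_congr rfl fun k _ => by rw [← toOld_apply]; rfl

theorem matDt_eq_sum (c : TimeChange A) (n : ℕ+) (X : BandMat (TimeSeries A)) :
    matDt n X = ∑ k ∈ Finset.Icc 1 n, dt n (c.new k) • X.mapEntries (c.dtNew k) :=
  ext_coeff fun j s => by
    rw [coeff_matDt, c.dt_eq_sum, coeff_sum]
    rfl

/-- The chain rule and the hypothesis are the same linear system in the derivatives along the new
times; it is unitriangular, so its solution is unique. -/
theorem mapEntries_dtNew (c : TimeChange A) {L : BandMat (TimeSeries A)}
    {Q : ℕ+ → BandMat (TimeSeries A)}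
    (h : ∀ n, matDt n L = ∑ k ∈ Finset.Icc 1 n, dt n (c.new k) • Q k) (n : ℕ+) :
    L.mapEntries (c.dtNew n) = Q n := by
  induction n using PNat.strongInductionOn with
  | _ n ih =>
    have h1 := (c.matDt_eq_sum n L).symm.trans (h n)
    rw [← Finset.Ico_insert_right (one_le : 1 ≤ n), Finset.sum_insert (by simp),
      Finset.sum_insert (by simp), c.new_triangular.dt_self, one_smul, one_smul,
      Finset.sum_congr rfl (fun k hk => by rw [ih k (Finset.mem_Ico.mp hk).2])] at h1
    exact add_right_cancel h1

theorem isMKPLax (c : TimeChange A) {L : BandMat (TimeSeries A)} (hL : L.IsLaxForm)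
    (h : ∀ n : ℕ+, L.mapEntries (c.dtNew n) = ⁅(L ^ (n : ℕ)).plus, L⁆) :
    IsMKPLax (L.mapEntries c.toNew) := by
  refine ⟨⟨fun j s hj => ?_, fun s => ?_⟩, fun n => ?_⟩
  · rw [coeff_mapEntries, hL.1 j s hj, map_zero]
  · rw [coeff_mapEntries, hL.2, c.toNew_one]
  · rw [← mapEntries_pow _ c.toNew_one c.toNew_mul, ← mapEntries_plus,
      ← mapEntries_lie _ c.toNew_mul, ← h n]
    refine ext_coeff fun j s => ?_
    rw [coeff_matDt, coeff_mapEntries, coeff_mapEntries, coeff_mapEntries]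
    exact (c.toNew_toOld _).symm

end TimeChange

end ChangeOfTimes

/-! ### Coefficients of B_n in powers of L. -/

section Recovery

open BandMat

variable {A : Type*} [CommRing A] {B : ℕ+ → BandMat (TimeSeries A)}

theorem eq_zero_of_sum_smul_pow {R : Type*} [CommRing R] {L : BandMat R} (hL : L.IsMonic 1)
    {δ : ℕ → R} {K : ℕ} (h : (∑ j ∈ Finset.range K, δ j • L ^ j).OrdLE (-1)) :
    ∀ j < K, δ j = 0 := by
  have hLj : ∀ j : ℕ, (L ^ j).IsMonic j := fun j => by simpa using hL.pow j
  induction K with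
  | zero => exact fun j hj => absurd hj (Nat.not_lt_zero j)
  | succ K ih =>
    have hK : δ K = 0 := by
      have h1 := h K 0 (by omega)
      rw [Finset.sum_range_succ, coeff_add, coeff_sum, coeff_smul, (hLj K).2, mul_one,
        Finset.sum_eq_zero fun j hj => by
          rw [coeff_smul, (hLj j).1 _ _ (by exact_mod_cast Finset.mem_range.mp hj), mul_zero],
        zero_add] at h1
      exact h1
    rw [Finset.sum_range_succ, hK, zero_smul, add_zero] at h
    intro j hj
    rcases Nat.lt_succ_iff_lt_or_eq.mp hj with hj | rfl
    · exact ih h j hj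
    · exact hK

/-- The matrices `B_n` are combinations of powers of `L` up to terms of negative order. -/
theorem exists_coefficients (hB : ∀ n : ℕ+, (B n).IsMonicUpper n)
    (hZS : ∀ m n : ℕ+, matDt n (B m) - matDt m (B n) + ⁅B m, B n⁆ = 0)
    {L : BandMat (TimeSeries A)} (hL : L.IsMonic 1) (hDL : ∀ m, covDt B m L = 0) :
    ∃ a : ℕ+ → ℕ → TimeSeries A, (∀ n, a n n = 1) ∧ (∀ (n : ℕ+) (j : ℕ), n < j → a n j = 0) ∧
      (∀ (n : ℕ+) (K : ℕ), n < K → (B n - ∑ j ∈ Finset.range K, a n j • L ^ j).OrdLE (-1)) ∧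
      ∀ m n j, dt m (a n j) = dt n (a m j) := by
  have hLj : ∀ j : ℕ, (L ^ j).IsMonic j := fun j => by simpa using hL.pow j
  have hDLj : ∀ m (j : ℕ), covDt B m (L ^ j) = 0 := fun m j => by
    induction j with
    | zero => rw [pow_zero, covDt_one]
    | succ j ih => rw [pow_succ, covDt_mul, ih, hDL, zero_mul, mul_zero, add_zero]
  have hex : ∀ n : ℕ+, ∃ a : ℕ → TimeSeries A,
      (B n - ∑ j ∈ Finset.Ico 0 ((n : ℕ) + 1), a j • L ^ j).OrdLE ((0 : ℕ) - 1) := fun n =>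
    exists_expansion hB hL n 0 (n + 1)
      (fun c j hj m hm => by
        rw [covDt_smul, hDLj, smul_zero, add_zero]
        exact ((hLj j).1.smul _).mono (by push_cast; omega))
      ((hB n).isMonic.1.mono (by push_cast; omega))
      (fun m hm => by
        rw [covDt_eq_matDt hZS]
        exact ((hB m).isMonic.ordLE_matDt n).mono (by push_cast; omega))
  choose a₀ ha₀ using hex
  -- Coefficients beyond j = n are irrelevant to the expansion; zero is chosen so that all sums can
  -- run up to a common K.
  set a : ℕ+ → ℕ → TimeSeries A := fun n j => if j ≤ n then a₀ n j else 0 with ha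
  have haY : ∀ (n : ℕ+) (K : ℕ), n < K →
      (B n - ∑ j ∈ Finset.range K, a n j • L ^ j).OrdLE (-1) := by
    intro n K hK
    have h1 := ha₀ n
    rw [← Finset.range_eq_Ico] at h1
    have h2 : ∑ j ∈ Finset.range ((n : ℕ) + 1), a₀ n j • L ^ j =
        ∑ j ∈ Finset.range K, a n j • L ^ j := by
      rw [← Finset.sum_subset (Finset.range_subset_range.mpr hK) fun j _ hj => by
        rw [Finset.mem_range] at hj
        rw [ha]
        simp only
        rw [if_neg (by omega), zero_smul]]
      refine Finset.sum_congr rfl fun j hj => ?_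
      rw [Finset.mem_range] at hj
      rw [ha]
      simp only
      rw [if_pos (by omega)]
    rw [← h2]
    exact h1.mono (by norm_num)
  refine ⟨a, fun n => ?_, fun n j hj => if_neg (by omega), haY, fun m n j => ?_⟩
  · rw [ha]
    simp only
    rw [if_pos le_rfl]
    exact eq_one_of_expansion hL (Nat.zero_le _) (hB n).isMonic (ha₀ n)
  · set K : ℕ := max (max (m : ℕ) n) j + 1 with hK
    set P : ℕ+ → BandMat (TimeSeries A) := fun n => ∑ j ∈ Finset.range K, a n j • L ^ j with hP
    have hPP : P n * P m = P m * P n := by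
      change Commute (P n) (P m)
      exact Commute.sum_left _ _ _ fun i _ => Commute.sum_right _ _ _ fun k _ =>
        ((Commute.pow_pow_self L i k).smul_left _).smul_right _
    have hDP : ∀ m n, covDt B m (P n) = ∑ j ∈ Finset.range K, dt m (a n j) • L ^ j := by
      intro m n
      rw [hP, covDt_sum]
      exact Finset.sum_congr rfl fun j _ => by rw [covDt_smul, hDLj, smul_zero, add_zero]
    have hYm := haY m K (by omega)
    have hYn := haY n K (by omega)
    change (B m - P m).OrdLE (-1) at hYm
    change (B n - P n).OrdLE (-1) at hYn
    -- As P_m and P_n commute, inserting B = P + (B - P) in the Zakharov–Shabat equation leaves on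
    -- the right only terms of negative order.
    have key : covDt B m (P n) - covDt B n (P m) =
        matDt n (B m - P m) - matDt m (B n - P n) + ⁅B m - P m, B n - P n⁆ := by
      have h1 := covDt_eq_matDt hZS m n
      have h2 : matDt m (B n) = matDt n (B m) + ⁅B m, B n⁆ := by
        rw [← h1, covDt]; abel
      simp only [covDt, matDt_sub, h2, Ring.lie_def, sub_mul, mul_sub, hPP]
      abel
    have h3 : (∑ j ∈ Finset.range K, (dt m (a n j) - dt n (a m j)) • L ^ j).OrdLE (-1) := by
      simp only [sub_smul, Finset.sum_sub_distrib]
      rw [← hDP, ← hDP, key]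
      exact ((hYm.matDt n).sub (hYn.matDt m)).add ((hYm.lie hYn).mono (by norm_num))
    exact sub_eq_zero.mp (eq_zero_of_sum_smul_pow hL h3 j (by omega))

/-- Over a ℚ-algebra a series killed by ∂/∂t_i has no monomial containing t_i; this is applied to
τ_n - t_n for all i ≤ n. -/
theorem isTriangular_of_dt [Algebra ℚ A] {τ : ℕ+ → TimeSeries A}
    (h0 : ∀ n, MvPowerSeries.coeff 0 (τ n) = 0) (h1 : ∀ n, dt n (τ n) = 1)
    (hlt : ∀ i n, i < n → dt i (τ n) = 0) : IsTriangular τ := by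
  intro n d hd
  refine ⟨?_, fun i hi => ?_⟩
  · rintro rfl
    exact hd (by rw [map_sub, h0, MvPowerSeries.coeff_zero_X, sub_zero])
  · by_contra hcon
    apply hd
    have hdt : dt i (τ n - MvPowerSeries.X n) = 0 := by
      rw [map_sub, sub_eq_zero]
      rcases eq_or_lt_of_le (not_lt.mp hcon) with rfl | hin
      · rw [h1]
        exact MvPowerSeries.pderiv_X_self.symm
      · rw [hlt i n hin]
        exact (MvPowerSeries.pderiv_X_of_ne hin.ne').symm
    have hdi := Finsupp.mem_support_iff.mp hi
    have h2 := congrArg (MvPowerSeries.coeff (d - Finsupp.single i 1)) hdt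
    rw [coeff_dt, Finsupp.sub_add_single_one_cancel hdi, map_zero, ← Nat.cast_add_one,
      mul_comm, ← nsmul_eq_mul, ← Nat.cast_smul_eq_nsmul ℚ] at h2
    have h3 := congrArg (fun x => ((((d - Finsupp.single i 1 : ℕ+ →₀ ℕ) i + 1 : ℕ) : ℚ)⁻¹) • x) h2
    simp only [smul_zero, smul_smul] at h3
    rwa [inv_mul_cancel₀ (Nat.cast_ne_zero.mpr (Nat.succ_ne_zero _)), one_smul] at h3

end Recovery

/-! ### The theorem. -/

theorem mainTheorem3 {A : Type*} [CommRing A] [Algebra ℂ A]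
    (B : ℕ+ → BandMat (TimeSeries A))
    (hB : ∀ n : ℕ+, (B n).IsMonicUpper n)
    (hZS : ∀ m n : ℕ+, matDt n (B m) - matDt m (B n) + ⁅B m, B n⁆ = 0) :
    (∃ L : BandMat (TimeSeries A), L.IsLaxForm ∧ ∀ n : ℕ+, matDt n L = ⁅B n, L⁆) ∧
    ∀ L : BandMat (TimeSeries A), L.IsLaxForm → (∀ n : ℕ+, matDt n L = ⁅B n, L⁆) →
      ∃ (c : TimeChange A) (f₀ : TimeSeries A),
        (∀ n : ℕ+, L.mapEntries (c.dtNew n) = ⁅(L ^ (n : ℕ)).plus, L⁆) ∧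
        IsMKPLax (L.mapEntries c.toNew) ∧
        ∀ n : ℕ+, B n =
          ∑ k ∈ Finset.Icc 1 n, dt n (c.new k) • (L ^ (k : ℕ)).plus +
            dt n f₀ • (1 : BandMat (TimeSeries A)) := by
  let _ : Algebra ℚ A := Algebra.compHom A (algebraMap ℚ ℂ)
  refine ⟨exists_lax hB hZS, fun L hL hBL => ?_⟩
  have hDL : ∀ m, covDt B m L = 0 := fun m => sub_eq_zero.mpr (hBL m)
  obtain ⟨a, ha1, ha0, haY, hac⟩ := exists_coefficients hB hZS (L := L) hL hDL
  -- The potentials τ_j with j ≥ 1 become the new times, and τ_0 becomes f₀.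
  choose τ hτ0 hτ using fun j : ℕ => exists_dt_eq (fun n => a n j) fun m n => hac m n j
  obtain ⟨c, hc⟩ := IsTriangular.exists_timeChange (isTriangular_of_dt (τ := fun n : ℕ+ => τ n)
    (fun n => hτ0 n) (fun n => (hτ n n).trans (ha1 n))
    (fun i n hin => (hτ n i).trans (ha0 i n hin)))
  have hcn : ∀ n k : ℕ+, dt n (c.new k) = a n k := fun n k => by rw [hc]; exact hτ k n
  have hBn : ∀ n : ℕ+, B n = ∑ k ∈ Finset.Icc 1 n, dt n (c.new k) • (L ^ (k : ℕ)).plus +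
      dt n (τ 0) • (1 : BandMat (TimeSeries A)) := by
    intro n
    have hsum : ∀ F : ℕ → TimeSeries A, ∑ k ∈ Finset.Icc 1 n, F (k : ℕ) + F 0 =
        ∑ j ∈ Finset.range ((n : ℕ) + 1), F j := by
      intro F
      rw [Finset.sum_range_succ', Finset.range_eq_Ico, Finset.sum_Ico_add' F 0 n 1]
      congr 1
      refine Finset.sum_bij (fun k _ => (k : ℕ)) ?_ ?_ ?_ ?_
      · intro k hk
        have h1 : (k : ℕ) ≤ n := (Finset.mem_Icc.mp hk).2
        have h2 := k.pos
        rw [Finset.mem_Ico]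
        omega
      · exact fun _ _ _ _ h => PNat.eq h
      · intro j hj
        rw [Finset.mem_Ico] at hj
        refine ⟨⟨j, by omega⟩, Finset.mem_Icc.mpr ⟨one_le, ?_⟩, rfl⟩
        change j ≤ (n : ℕ)
        omega
      · exact fun _ _ => rfl
    refine BandMat.ext_coeff fun j s => ?_
    simp only [BandMat.coeff_add, BandMat.coeff_sum, BandMat.coeff_smul, BandMat.coeff_plus, hcn,
      hτ]
    -- On diagonals j ≥ 0 this is the expansion of B_n, with L^0 = 1 giving the f₀ term; on
    -- diagonals j < 0 both sides vanish.
    by_cases hj : 0 ≤ j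
    · have h1 := haY n (n + 1) (Nat.lt_succ_self _) j s (by omega)
      simp only [BandMat.coeff_sub, BandMat.coeff_sum, BandMat.coeff_smul] at h1
      simp only [if_pos hj]
      rw [← pow_zero L, hsum fun k => a n k * (L ^ k).coeff j s]
      exact sub_eq_zero.mp h1
    · simp only [if_neg hj, mul_zero, Finset.sum_const_zero, zero_add]
      rw [BandMat.coeff_one, if_neg (by omega), mul_zero, (hB n).1 j s (Or.inl (by omega))]
  have hLax : ∀ n : ℕ+, L.mapEntries (c.dtNew n) = ⁅(L ^ (n : ℕ)).plus, L⁆ :=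
    c.mapEntries_dtNew (Q := fun k => ⁅(L ^ (k : ℕ)).plus, L⁆) fun n => by
      rw [hBL n, hBn n, BandMat.add_lie', BandMat.smul_lie',
        show ⁅(1 : BandMat (TimeSeries A)), L⁆ = 0 by simp [Ring.lie_def], smul_zero, add_zero,
        Ring.lie_def, Finset.sum_mul, Finset.mul_sum, ← Finset.sum_sub_distrib]
      exact Finset.sum_congr rfl fun k _ => by rw [← BandMat.smul_lie', Ring.lie_def]
  exact ⟨c, τ 0, hLax, c.isMKPLax hL hLax, hBn⟩
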